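/- \textbf{Setting.} Let $\mathcal X$ and $\mathcal Y$ be finite non-empty sets, $\mathcal Y$ being equipped with an abelian group operation $\oplus$ (e.g. bitwise XOR). A $q$-query oracle quantum algorithm $\mathcal A$ consists of a unit vector $|\phi_0\rangle$ in a finite-dimensional space with a control qubit $C$, registers $X$ and $Y$ with bases indexed by $\mathcal X$ and $\mathcal Y$, and an arbitrary further register $Z$, and of operators $A_1,\dots,A_q$ on this space, each of which is a unitary, possibly preceded or followed by an orthogonal projection (in which case $\mathcal A$ aborts on the other outcome). For $H:\mathcal X\to\mathcal Y$, the algorithm $\mathcal A^H$ computes $|\phi_q^H\rangle=A_q\mathcal O^H\cdots A_1\mathcal O^H|\phi_0\rangle$, where $\mathcal O^H|c\rangle|x\rangle|y\rangle=|c\rangle|x\rangle|y\oplus c\cdot H(x)\rangle$; it outputs the outcome $x$ of measuring $X$ in the computational basis, together with the state $z$ of $Z$. A quantum predicate $V$ is a family of orthogonal projections $\Pi_{x,\Theta}$ on $Z$ ($x\in\mathcal X$, $\Theta\in\mathcal Y$), and $V(x,\Theta,z)$ is the event that measuring $z$ with $\{\Pi_{x,\Theta},\mathbb 1-\Pi_{x,\Theta}\}$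 yields the outcome $\Pi_{x,\Theta}$; thus $\Pr[x=x_\circ\wedge V(x,H(x),z):(x,z)\leftarrow\mathcal A^H]=\|(|x_\circ\rangle\langle x_\circ|\otimes\Pi_{x_\circ,H(x_\circ)})|\phi_q^H\rangle\|_2^2$ for each fixed $H$. \textbf{Theorem (Measure-and-reprogram, single input).} There exists a black-box two-stage quantum algorithm $\mathcal S$ with the following property. Let $\mathcal X,\mathcal Y$ be as above, and let $\mathcal A$ be an arbitrary oracle quantum algorithm that makes $q$ queries to a uniformly random $H:\mathcal X\to\mathcal Y$ and that outputs some $x\in\mathcal X$ and a (possibly quantum) output $z$. Then the algorithm $\mathcal S^{\mathcal A}$, which receives $q$ and the bit lengths of the elements of $\mathcal X$ and $\mathcal Y$ as inputs, runs $\mathcal A$ step by step and has access to its registers $C,X,Y$ only, outputs some $x\in\mathcal X$ in the first stage and, upon a uniformly random $\Theta\in\mathcal Y$ as input to the second stage, a (possibly quantum) output $z$, so that for any $x_\circ\in\mathcal X$ and any quantum predicate $V$: $$\Pr_\Theta\bigl[x=x_\circ\wedge V(x,\Theta,z):(x,z)\leftarrow\langle\mathcal S^{\mathcal A},\Theta\rangle\bigr]\;\ge\;\frac1{(2q+1)^2}\,\Pr_H\bigl[x=x_\circ\wedge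 V(x,H(x),z):(x,z)\leftarrow\mathcal A^H\bigr].$$ Furthermore, $\mathcal S$ runs in time polynomial in $q$, $\log|\mathcal X|$ and $\log|\mathcal Y|$, where a step of $\mathcal A$ counts as one unit of time, and the polynomial does not depend on $\mathcal X$, $\mathcal Y$ and $\mathcal A$. (The time is counted on a machine with logarithmic-cost arithmetic on classical variables and elementary gates on work qubits, with uniform sampling from an initial segment of $\mathbb N$ at logarithmic cost; it can sample and add elements of $\mathcal Y$ and measure $X$ at a cost of the order of their bit length, and read bits of $C$ and $X$, the elements of $\mathcal X$ being encoded injectively by bit strings of length $\lceil\log_2|\mathcal X|\rceil$.) -/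

import Mathlib

/-! ### Oracle quantum algorithms -/

/-- Computational basis of the registers of an oracle algorithm: control bit `C`, query/output
register `X`, response register `Y`, and a private register `Z`, which contains the output `z`
(and whatever else the algorithm keeps). -/
abbrev Reg (X Y Z : Type*) := Bool × X × Y × Z

/-- Squared Euclidean norm of a vector. -/
noncomputable def sqNorm {ι : Type*} [Fintype ι] (ψ : ι → ℂ) : ℝ := ∑ b, ‖ψ b‖ ^ 2

/-- The operations an oracle algorithm may perform between two queries: a unitary, possibly
preceded or followed by an orthogonal projection (the run aborts on the other outcome). -/
def IsStep {ι : Type*} [Fintype ι] [DecidableEq ι] (M : Matrix ι ι ℂ) : Prop :=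
  ∃ U ∈ Matrix.unitaryGroup ι ℂ, ∃ P : Matrix ι ι ℂ, IsStarProjection P ∧ (M = U * P ∨ M = P * U)

/-- An oracle quantum algorithm making `q` (controlled) queries to a function `X → Y`. -/
structure OracleAlgorithm (X Y Z : Type*) [Fintype X] [DecidableEq X] [Fintype Y] [DecidableEq Y]
    [Fintype Z] [DecidableEq Z] (q : ℕ) where
  start : Reg X Y Z → ℂ
  start_norm : sqNorm start = 1
  step : Fin q → Matrix (Reg X Y Z) (Reg X Y Z) ℂ
  step_ok : ∀ i, IsStep (step i)

/-- The query unitary `|c⟩|x⟩|y⟩ ↦ |c⟩|x⟩|y + c·H(x)⟩`, written on amplitudes. -/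
def query {X Y Z : Type*} [AddCommGroup Y] (H : X → Y) (ψ : Reg X Y Z → ℂ) : Reg X Y Z → ℂ :=
  fun (c, x, y, z) => ψ (c, x, y - (if c then H x else 0), z)

namespace OracleAlgorithm

variable {X Y Z : Type*} [Fintype X] [DecidableEq X] [Fintype Y] [DecidableEq Y] [AddCommGroup Y]
  [Fintype Z] [DecidableEq Z] {q : ℕ}

/-- Apply the `(j+1)`-st operation of the algorithm (nothing if there is none). -/
def applyStep (A : OracleAlgorithm X Y Z q) (j : ℕ) (ψ : Reg X Y Z → ℂ) : Reg X Y Z → ℂ :=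
  if h : j < q then (A.step ⟨j, h⟩).mulVec ψ else ψ

/-- The state after `j` queries, each followed by the corresponding operation. -/
def state (A : OracleAlgorithm X Y Z q) (H : X → Y) : ℕ → (Reg X Y Z → ℂ)
  | 0 => A.start
  | j + 1 => A.applyStep j (query H (A.state H j))

/-- The probability, over a uniformly random `H`, that the algorithm outputs `x₀` and that the
register `Z` then satisfies the projective predicate `V x₀ (H x₀)`. -/
noncomputable def winProb (A : OracleAlgorithm X Y Z q) (x₀ : X) (V : X → Y → Matrix Z Z ℂ) : ℝ :=
  (∑ H : X → Y, ∑ c : Bool, ∑ y : Y,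
    sqNorm ((V x₀ (H x₀)).mulVec fun z => A.state H q (c, x₀, y, z))) / Fintype.card (X → Y)

end OracleAlgorithm

/-! ### Simulators: hybrid programs with a step count

A simulator owns number-valued classical variables, cells holding elements of `Y`, and work qubits
addressed by natural numbers. It runs the algorithm `A` one operation at a time, and it can read
and answer the queries of `A`, or measure the query register; the private register of `A` is out
of its reach. -/

/-- Arithmetic expressions in the classical variables. -/
inductive Expr : Type
  | const (n : ℕ)
  | var (i : ℕ)
  | add (a b : Expr)
  | sub (a b : Expr)
  | mul (a b : Expr)
  | div (a b : Expr)
  | mod (a b : Expr)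

namespace Expr

/-- Value of an expression (subtraction is truncated, division rounds down). -/
def eval (σ : ℕ → ℕ) : Expr → ℕ
  | const n => n
  | var i => σ i
  | add a b => a.eval σ + b.eval σ
  | sub a b => a.eval σ - b.eval σ
  | mul a b => a.eval σ * b.eval σ
  | div a b => a.eval σ / b.eval σ
  | mod a b => a.eval σ % b.eval σ

/-- Logarithmic cost of evaluating an expression: every intermediate result is charged its
bit length. -/
def cost (σ : ℕ → ℕ) : Expr → ℕ
  | const n => 1 + n.size
  | var i => 1 + i.size + (σ i).size
  | add a b => 1 + a.cost σ + b.cost σ + (a.eval σ + b.eval σ).size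
  | sub a b => 1 + a.cost σ + b.cost σ + (a.eval σ - b.eval σ).size
  | mul a b => 1 + a.cost σ + b.cost σ + (a.eval σ * b.eval σ).size
  | div a b => 1 + a.cost σ + b.cost σ + (a.eval σ / b.eval σ).size
  | mod a b => 1 + a.cost σ + b.cost σ + (a.eval σ % b.eval σ).size

end Expr

/-- Programs of a simulator. Addresses of qubits and cells and indices of bits are expressions. -/
inductive Prog : Type
  | skip
  | seq (p p' : Prog)
  /-- `v := e` -/
  | assign (v : ℕ) (e : Expr)
  /-- `v` := a uniformly random element of `{0, …, e}` -/
  | rand (v : ℕ) (e : Expr)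
  /-- `p` if `e ≠ 0`, and `p'` otherwise -/
  | ite (e : Expr) (p p' : Prog)
  /-- run `p` for `v = 0, …, e - 1`, with `e` evaluated once -/
  | loop (v : ℕ) (e : Expr) (p : Prog)
  /-- Pauli `X` gate on work qubit `t` -/
  | flip (t : Expr)
  /-- flip qubit `t` if qubits `a` and `b` are set (a CNOT for `a = b`) -/
  | toffoli (a b t : Expr)
  /-- Hadamard gate on work qubit `t` -/
  | hadamard (t : Expr)
  /-- `π/8` gate on work qubit `t` -/
  | phase (t : Expr)
  /-- measure work qubit `t`, and store the outcome in `v` -/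
  | measure (v : ℕ) (t : Expr)
  /-- uniformly random element of `Y` into cell `a` -/
  | randY (a : Expr)
  /-- flip qubit `t` if the control register of `A` is set -/
  | readC (t : Expr)
  /-- flip qubit `t` if the `k`-th bit of the query register of `A` is set -/
  | readX (k t : Expr)
  /-- add the content of cell `a` to the response register of `A` if qubit `t` is set -/
  | addY (a t : Expr)
  /-- measure the query register of `A`, and store the outcome as output of the simulator -/
  | measureX
  /-- flip qubit `t` if the `k`-th bit of the stored outcome is set -/
  | readOut (k t : Expr)
  /-- let `A` perform its next operation -/
  | call

/-- One branch (history of random choices and measurement outcomes) of a run. -/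
structure Branch (X Y Z : Type*) where
  /-- classical variables -/
  vars : ℕ → ℕ
  /-- cells with elements of `Y` -/
  cells : ℕ → Y
  /-- output of the first stage -/
  out : Option X
  /-- number of operations of `A` performed so far -/
  pos : ℕ
  /-- elapsed time -/
  time : ℕ
  /-- probability of the classical random choices made so far -/
  prob : ℝ
  /-- joint state of the work qubits and of `A`, after the measurement outcomes obtained so far and
  not renormalized, so that its squared norm is the probability of these outcomes; a basis state
  of the work qubits is given by the finite set of qubits that are `1` -/
  ket : Finset ℕ → Reg X Y Z → ℂ

/-- Flip qubit `t` if `b` holds. -/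
def flipIf (b : Bool) (t : ℕ) (w : Finset ℕ) : Finset ℕ := if b then symmDiff w {t} else w

section Semantics

variable {X Y Z : Type*} [Fintype X] [DecidableEq X] [Fintype Y] [DecidableEq Y] [AddCommGroup Y]
  [Fintype Z] [DecidableEq Z] {q : ℕ}

namespace Branch

/-- Let time pass. -/
def tick (n : ℕ) (s : Branch X Y Z) : Branch X Y Z := { s with time := s.time + n }

/-- Set a classical variable. -/
def setVar (v n : ℕ) (s : Branch X Y Z) : Branch X Y Z :=
  { s with vars := Function.update s.vars v n }

/-- Set a cell. -/
def setCell (a : ℕ) (y : Y) (s : Branch X Y Z) : Branch X Y Z :=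
  { s with cells := Function.update s.cells a y }

/-- Replace the quantum state. -/
def setKet (ψ : Finset ℕ → Reg X Y Z → ℂ) (s : Branch X Y Z) : Branch X Y Z := { s with ket := ψ }

end Branch

/-- The bit length of the elements of a finite set. -/
def bits (α : Type*) [Fintype α] : ℕ := Nat.clog 2 (Fintype.card α)

/-- All branches of a run of a program, for an encoding of `X` by strings of `log |X|` bits.
Every instruction costs one unit of time, plus the cost of its expressions, plus the bit
length of the elements of `X` or `Y` that it handles. -/
noncomputable def run (enc : X ↪ Fin (2 ^ bits X)) (A : OracleAlgorithm X Y Z q) :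
    Prog → Branch X Y Z → Multiset (Branch X Y Z)
  | .skip, s => {s}
  | .seq p p', s => (run enc A p s).bind (run enc A p')
  | .assign v e, s => {(s.setVar v (e.eval s.vars)).tick (1 + v.size + e.cost s.vars)}
  | .rand v e, s =>
      (Multiset.range (e.eval s.vars + 1)).map fun n =>
        ({ s with prob := s.prob / (e.eval s.vars + 1) }.setVar v n).tick
          (1 + v.size + e.cost s.vars)
  | .ite e p p', s =>
      if e.eval s.vars ≠ 0 then run enc A p (s.tick (1 + e.cost s.vars))
      else run enc A p' (s.tick (1 + e.cost s.vars))
  | .loop v e p, s =>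
      Nat.rec (motive := fun _ => Multiset (Branch X Y Z)) {s.tick (1 + e.cost s.vars)}
        (fun k L => L.bind fun s' => run enc A p ((s'.setVar v k).tick (1 + v.size + k.size)))
        (e.eval s.vars)
  | .flip t, s =>
      {(s.setKet fun w r => s.ket (flipIf true (t.eval s.vars) w) r).tick (1 + t.cost s.vars)}
  | .toffoli a b t, s =>
      let a' := a.eval s.vars
      let b' := b.eval s.vars
      let t' := t.eval s.vars
      {(s.setKet fun w r => s.ket (flipIf (a' ∈ w ∧ b' ∈ w ∧ t' ≠ a' ∧ t' ≠ b') t' w) r).tick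
        (1 + a.cost s.vars + b.cost s.vars + t.cost s.vars)}
  | .hadamard t, s =>
      let t' := t.eval s.vars
      {(s.setKet fun w r =>
          (s.ket (w.erase t') r + (if t' ∈ w then -1 else 1) * s.ket (insert t' w) r)
            / (Real.sqrt 2 : ℂ)).tick (1 + t.cost s.vars)}
  | .phase t, s =>
      {(s.setKet fun w r =>
          (if t.eval s.vars ∈ w then Complex.exp (Real.pi / 4 * Complex.I) else 1)
            * s.ket w r).tick (1 + t.cost s.vars)}
  | .measure v t, s =>
      (Finset.univ : Finset Bool).val.map fun o =>
        ((s.setKet fun w r => if decide (t.eval s.vars ∈ w) = o then s.ket w r else 0).setVar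
          v o.toNat).tick (1 + v.size + t.cost s.vars)
  | .randY a, s =>
      (Finset.univ : Finset Y).val.map fun y =>
        ({ s with prob := s.prob / Fintype.card Y }.setCell (a.eval s.vars) y).tick
          (1 + a.cost s.vars + bits Y)
  | .readC t, s =>
      {(s.setKet fun w r => s.ket (flipIf r.1 (t.eval s.vars) w) r).tick (1 + t.cost s.vars)}
  | .readX k t, s =>
      {(s.setKet fun w r =>
          s.ket (flipIf ((enc r.2.1).val.testBit (k.eval s.vars)) (t.eval s.vars) w) r).tick
        (1 + k.cost s.vars + t.cost s.vars)}
  | .addY a t, s =>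
      {(s.setKet fun w r => s.ket w (r.1, r.2.1,
          r.2.2.1 - (if t.eval s.vars ∈ w then s.cells (a.eval s.vars) else 0), r.2.2.2)).tick
        (1 + a.cost s.vars + t.cost s.vars + bits Y)}
  | .measureX, s =>
      (Finset.univ : Finset X).val.map fun x =>
        { s.setKet (fun w r => if r.2.1 = x then s.ket w r else 0) with out := some x }.tick
          (1 + bits X)
  | .readOut k t, s =>
      {(s.setKet fun w r =>
          s.ket (flipIf (s.out.any fun x => (enc x).val.testBit (k.eval s.vars))
            (t.eval s.vars) w) r).tick (1 + k.cost s.vars + t.cost s.vars)}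
  | .call, s =>
      {({ s with pos := s.pos + 1 }.setKet fun w => A.applyStep s.pos (s.ket w)).tick 1}

/-- A two-stage simulator. -/
structure Simulator where
  first : Prog
  second : Prog

namespace Simulator

/-- The initial configuration: all work qubits are `0`, `A` is in its initial state, and the
inputs of the simulator are `q`, `log |X|` and `log |Y|`. -/
noncomputable def initial (A : OracleAlgorithm X Y Z q) : Branch X Y Z where
  vars := fun i => if i = 0 then q else if i = 1 then bits X else if i = 2 then bits Y else 0
  cells := fun _ => 0
  out := none
  pos := 0
  time := 0
  prob := 1
  ket := fun w => if w = ∅ then A.start else 0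

/-- The branches of the first stage. -/
noncomputable def runFirst (S : Simulator) (enc : X ↪ Fin (2 ^ bits X))
    (A : OracleAlgorithm X Y Z q) : Multiset (Branch X Y Z) :=
  run enc A S.first (initial A)

/-- The branches of the second stage, which continues the branch `s` of the first one after
receiving the input `θ` in cell `0`. -/
noncomputable def runSecond (S : Simulator) (enc : X ↪ Fin (2 ^ bits X))
    (A : OracleAlgorithm X Y Z q) (s : Branch X Y Z) (θ : Y) : Multiset (Branch X Y Z) :=
  run enc A S.second (s.setCell 0 θ)

/-- The probability of the branch `s` together with the event that the register `Z` satisfies the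
projection `P`. -/
noncomputable def branchProb (P : Matrix Z Z ℂ) (s : Branch X Y Z) : ℝ :=
  s.prob * ∑' w : Finset ℕ, ∑ c : Bool, ∑ x : X, ∑ y : Y,
    sqNorm (P.mulVec fun z => s.ket w (c, x, y, z))

/-- The probability, over a uniformly random `θ`, that the first stage outputs `x₀` and that,
after the second stage was run on input `θ`, the output register `Z` satisfies `V x₀ θ`. -/
noncomputable def winProb (S : Simulator) (enc : X ↪ Fin (2 ^ bits X))
    (A : OracleAlgorithm X Y Z q) (x₀ : X) (V : X → Y → Matrix Z Z ℂ) : ℝ :=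
  ((S.runFirst enc A).map fun s =>
    if s.out = some x₀ then
      (∑ θ : Y, ((S.runSecond enc A s θ).map (branchProb (V x₀ θ))).sum) / Fintype.card Y
    else 0).sum

end Simulator

end Semantics

/-! Fix `x₀` and `θ`, and let H' be H reprogrammed to `θ` at `x₀`. Turn H' into H one query at a
time, beginning with the first query. Two consecutive hybrids differ in a single query i, and there
only on the component |x₀⟩ of the query register, because H and H' agree elsewhere. Hence the final
state under H' is the final state under H plus, for each i, the difference of two runs: in both,
query i of the run under H is projected to `x₀`, and H' takes over either at this query or at the
next one (`state_update_eq`). With the output projected to `x₀`, this is a signed sum of 2q+1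
vectors, each the unnormalized final state of a run that measures one query, or the output, with
outcome `x₀`. Cauchy–Schwarz costs a factor 2q+1 (`sqNorm_state_update_le`), and picking one of
these runs at random costs another. If H and `θ` are uniform and independent, then H' is uniform and
takes the value `θ` at `x₀`, which gives the bound for a simulator holding a uniform H
(`winProb_le`).

A uniform H is too large to be sampled in polynomial time. But amplitudes after q queries are linear
combinations of functions of at most q values of H, so success probabilities involve at most 2q
values at once, and their average is unchanged if H is drawn from a 2q-wise independent family
(`average_successProb_residueHash`). As elements of `Y` can only be sampled and added, polynomials
over a field are not available. Instead, the hash of x is the sum, over all small moduli, of a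
random table entry selected by the residue of x. Among any 2q points each one is isolated by some
modulus, since a product of differences is too small to be divisible by every number up to the bound
(`exists_isolating_modulus`). So the map from tables to the values on these points is a surjective
homomorphism and preserves uniformity (`residueHashHom_surjective`).

It remains to implement this coherently. A query is answered by comparing it bitwise with the
measured point, computing its residues by finite automata with one-hot states, adding the selected
cells, and uncomputing all work qubits, so that exactly the query unitary remains
(`triple_answerQuery`). The number of loop iterations is polynomial, which gives the running time
(`run_bounded`, `PolyBounded.timeBound`). -/

open Finset

/-! ### A cover-free family of residues -/

/-- A positive number below `2 ^ m` has a non-divisor of size at most `2 * m`. -/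
theorem exists_not_dvd_of_lt_two_pow {m D : ℕ} (hm : 4 ≤ m) (hD : 0 < D) (hlt : D ≤ 2 ^ m) :
    ∃ a < 2 * m, ¬ (a + 1) ∣ D := by
  by_contra! h
  -- Every prime power dividing the central binomial coefficient is at most 2m, so if all numbers up
  -- to 2m divide D, then so does the coefficient. As it exceeds 4^m / m, it is too large for this.
  have hdvd : m.centralBinom ∣ D := by
    rw [Nat.dvd_iff_prime_pow_dvd_dvd]
    intro p k hp hk
    have hk' : k ≤ m.centralBinom.factorization p :=
      (hp.pow_dvd_iff_le_factorization (Nat.centralBinom_ne_zero m)).1 hk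
    have hle : p ^ k ≤ 2 * m := (Nat.pow_le_pow_right hp.pos hk').trans
      (Nat.pow_factorization_choose_le (by omega))
    have hpos : 0 < p ^ k := pow_pos hp.pos k
    have := h (p ^ k - 1) (by omega)
    rwa [Nat.sub_add_cancel hpos] at this
  have h1 := Nat.four_pow_lt_mul_centralBinom m hm
  have h2 : m * m.centralBinom ≤ 2 ^ m * 2 ^ m :=
    Nat.mul_le_mul m.lt_two_pow_self.le ((Nat.le_of_dvd hD hdvd).trans hlt)
  rw [← mul_pow] at h2
  exact absurd h1 (by simpa using h2)

/-- Number of moduli that suffices to isolate each of `k` numbers below `2 ^ n` from the others. -/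
def numModuli (n k : ℕ) : ℕ := 2 * (n * k + 4)

/-- A modulus that fails to isolate x divides one of the differences, hence their product, which is
nonzero and at most 2^(nk). The summand 4 in `numModuli` serves the hypothesis `4 ≤ m` of the
previous lemma. -/
theorem exists_isolating_modulus {X : Type*} [DecidableEq X] {e : X → ℕ}
    (he : Function.Injective e) {n k : ℕ} (hn : ∀ x, e x < 2 ^ n) (S : Finset X)
    (hS : S.card ≤ k) (x : X) :
    ∃ a < numModuli n k, ∀ x' ∈ S, x' ≠ x → e x' % (a + 1) ≠ e x % (a + 1) := by
  set D := ∏ x' ∈ S.erase x, ((e x' : ℤ) - e x).natAbs with hDdef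
  have hpos : 0 < D := by
    refine Finset.prod_pos fun x' hx' => ?_
    have := he.ne (Finset.ne_of_mem_erase hx')
    omega
  have hle : D ≤ 2 ^ (n * k + 4) := by
    calc D ≤ ∏ _x' ∈ S.erase x, 2 ^ n := by
          refine Finset.prod_le_prod' fun x' _ => ?_
          have h1 := hn x'
          have h2 := hn x
          omega
      _ = 2 ^ (n * (S.erase x).card) := by rw [Finset.prod_const, ← pow_mul]
      _ ≤ 2 ^ (n * k + 4) := by
          refine Nat.pow_le_pow_right two_pos ?_
          have : (S.erase x).card ≤ k := (Finset.card_erase_le).trans hS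
          nlinarith
  obtain ⟨a, ha, hnd⟩ := exists_not_dvd_of_lt_two_pow (by omega) hpos hle
  refine ⟨a, ha, fun x' hx' hne heq => hnd ?_⟩
  refine dvd_trans ?_ (Finset.dvd_prod_of_mem _ (Finset.mem_erase.2 ⟨hne, hx'⟩))
  have : ((a + 1 : ℕ) : ℤ) ∣ (e x' : ℤ) - e x :=
    (Nat.modEq_iff_dvd.1 (show e x ≡ e x' [MOD a + 1] from heq.symm))
  exact Int.natCast_dvd.1 this

/-! ### A hash family with values in an arbitrary abelian group -/

/-- The hash function given by a table of elements of `Y`: sum, over all moduli `a + 1 ≤ M`, of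
the entry belonging to `a` and to the residue of the argument. -/
def residueHash {X Y : Type*} [AddCommMonoid Y] (e : X → ℕ) (M : ℕ) (c : ℕ → Y) (x : X) : Y :=
  ∑ a ∈ range M, c (1 + (a * M + e x % (a + 1)))

/-- The cells `1, …, L` filled with a table. -/
def tableCells {Y : Type*} [Zero Y] {L : ℕ} (f : Fin L → Y) (j : ℕ) : Y :=
  if h : j - 1 < L ∧ j ≠ 0 then f ⟨j - 1, h.1⟩ else 0

theorem tableCells_one_add {Y : Type*} [Zero Y] {L : ℕ} (f : Fin L → Y) {j : ℕ} (hj : j < L) :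
    tableCells f (1 + j) = f ⟨j, hj⟩ := by
  have h : 1 + j - 1 = j := by omega
  simp [tableCells, h, hj]

theorem add_mod_lt_mul {M a e : ℕ} (ha : a < M) : a * M + e % (a + 1) < M * M := by
  have := Nat.mod_lt e (Nat.succ_pos a)
  nlinarith

theorem position_injective {M a b s t : ℕ} (hs : s < M) (ht : t < M)
    (h : a * M + s = b * M + t) : a = b ∧ s = t := by
  have hM : 0 < M := by omega
  have h1 : (a * M + s) / M = a := by
    rw [mul_comm, Nat.mul_add_div hM, Nat.div_eq_of_lt hs, add_zero]
  have h2 : (b * M + t) / M = b := by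
    rw [mul_comm, Nat.mul_add_div hM, Nat.div_eq_of_lt ht, add_zero]
  have hab : a = b := by rw [← h1, h, h2]
  subst hab
  exact ⟨rfl, by omega⟩

/-- The values of the hash function on a finite set, as a homomorphism in the table. -/
def residueHashHom {X Y : Type*} [AddCommGroup Y] (e : X → ℕ) (M : ℕ) (S : Finset X) :
    (Fin (M * M) → Y) →+ (S → Y) where
  toFun f x := residueHash e M (tableCells f) x
  map_zero' := by
    ext x
    simp [residueHash, tableCells]
  map_add' f g := by
    ext x
    simp only [residueHash, Pi.add_apply, ← Finset.sum_add_distrib]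
    refine Finset.sum_congr rfl fun a _ => ?_
    simp only [tableCells]
    split_ifs <;> simp

/-- Prescribed values are attained by writing `h x` into the entry for the residue of x modulo its
isolating modulus. No other point of S reads this entry. -/
theorem residueHashHom_surjective {X Y : Type*} [DecidableEq X] [AddCommGroup Y] {e : X → ℕ}
    (he : Function.Injective e) {n k : ℕ} (hn : ∀ x, e x < 2 ^ n) (S : Finset X)
    (hS : S.card ≤ k) :
    Function.Surjective (residueHashHom (Y := Y) e (numModuli n k) S) := by
  intro h
  choose a ha hiso using exists_isolating_modulus he hn S hS
  set M := numModuli n k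
  refine ⟨fun j => ∑ x : S, if (j : ℕ) = a x * M + e x % (a x + 1) then h x else 0, ?_⟩
  ext x
  -- Among the entries read by x, only its own isolating one has been filled.
  have key : ∀ b ∈ range M, ∀ x' : S,
      b * M + e x % (b + 1) = a x' * M + e x' % (a x' + 1) ↔ (b = a x' ∧ x' = x) := by
    intro b hb x'
    rw [Finset.mem_range] at hb
    constructor
    · intro heq
      have hlt1 : e x % (b + 1) < b + 1 := Nat.mod_lt _ (Nat.succ_pos b)
      have hlt2 : e x' % (a x' + 1) < a x' + 1 := Nat.mod_lt _ (Nat.succ_pos _)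
      have ha' := ha x'
      obtain ⟨h1, h2⟩ := position_injective (by omega) (by omega) heq
      refine ⟨h1, ?_⟩
      subst h1
      by_contra hne
      exact hiso x' x x.2 (fun h => hne (Subtype.ext h.symm)) h2
    · rintro ⟨rfl, rfl⟩
      rfl
  change residueHash e M _ _ = _
  calc _ = ∑ b ∈ range M, ∑ x' : S, if b = a x' ∧ x' = x then h x' else 0 := by
        refine Finset.sum_congr rfl fun b hb => ?_
        rw [tableCells_one_add _ (add_mod_lt_mul (Finset.mem_range.1 hb))]
        refine Finset.sum_congr rfl fun x' _ => ?_
        simp only [key b hb x']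
    _ = h x := by
        rw [Finset.sum_comm, Finset.sum_eq_single x]
        · simp [ha x]
        · intro x' _ hne
          simp [hne]
        · simp

/-- All fibres are cosets of the kernel and so have the same size: the uniform distribution is
mapped to the uniform one. -/
theorem average_comp_of_surjective {G K : Type*} [AddCommGroup G] [AddCommGroup K] [Fintype G]
    [Fintype K] [DecidableEq K] (π : G →+ K) (hπ : Function.Surjective π) (φ : K → ℂ) :
    (∑ g, φ (π g)) / Fintype.card G = (∑ k, φ k) / Fintype.card K := by
  set m := #{g | π g = 0}
  have hfib : ∀ k, #{g | π g = k} = m := fun k =>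
    AddMonoidHom.card_fiber_eq_of_mem_range π (hπ k) (hπ 0)
  have hsum : ∀ ψ : K → ℂ, ∑ g, ψ (π g) = m * ∑ k, ψ k := by
    intro ψ
    rw [← Finset.sum_fiberwise Finset.univ π, Finset.mul_sum]
    refine Finset.sum_congr rfl fun k _ => ?_
    rw [Finset.sum_congr rfl (g := fun _ => ψ k) (fun g hg => by rw [(Finset.mem_filter.1 hg).2]),
      Finset.sum_const, hfib, nsmul_eq_mul]
  have hcard : (Fintype.card G : ℂ) = m * Fintype.card K := by
    simpa using hsum fun _ => 1
  have hm : (m : ℂ) ≠ 0 := by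
    intro h0
    rw [h0, zero_mul] at hcard
    exact (Nat.cast_ne_zero.2 Fintype.card_ne_zero) hcard
  rw [hsum, hcard, mul_div_mul_left _ _ hm]

/-- A function of `H : X → Y` which depends on the values of `H` on a set `S` only. -/
def DependsOnlyOn {X Y R : Type*} (S : Finset X) (φ : (X → Y) → R) : Prop :=
  ∀ H H' : X → Y, (∀ x ∈ S, H x = H' x) → φ H = φ H'

/-- This is k-wise independence. `φ` factors through restriction to S (via extension by zero,
`ext0`), and both tables and functions map onto `S → Y` by surjective homomorphisms. -/
theorem average_residueHash {X Y : Type*} [Fintype X] [DecidableEq X] [Fintype Y] [DecidableEq Y]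
    [AddCommGroup Y] {e : X → ℕ} (he : Function.Injective e) {n k : ℕ} (hn : ∀ x, e x < 2 ^ n)
    {S : Finset X} (hS : S.card ≤ k) {φ : (X → Y) → ℂ} (hφ : DependsOnlyOn S φ) :
    (∑ f : Fin (numModuli n k * numModuli n k) → Y,
        φ (residueHash e (numModuli n k) (tableCells f))) /
        Fintype.card (Fin (numModuli n k * numModuli n k) → Y) =
      (∑ H, φ H) / Fintype.card (X → Y) := by
  let restr : (X → Y) →+ (S → Y) :=
    { toFun := fun H x => H x, map_zero' := rfl, map_add' := fun _ _ => rfl }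
  let ext0 : (S → Y) → (X → Y) := fun h x => if hx : x ∈ S then h ⟨x, hx⟩ else 0
  have hext : ∀ H : X → Y, φ (ext0 fun x => H x) = φ H := fun H =>
    hφ _ _ fun x hx => by simp [ext0, hx]
  have hsurj : Function.Surjective restr := fun h =>
    ⟨ext0 h, by ext x; simp [restr, ext0]⟩
  have h1 := average_comp_of_surjective _
    (residueHashHom_surjective (Y := Y) he hn S hS) fun h => φ (ext0 h)
  have h2 := average_comp_of_surjective restr hsurj fun h => φ (ext0 h)
  calc _ = (∑ f : Fin (numModuli n k * numModuli n k) → Y,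
        φ (ext0 (residueHashHom e (numModuli n k) S f))) /
        Fintype.card (Fin (numModuli n k * numModuli n k) → Y) := by
        congr 1
        exact Finset.sum_congr rfl fun f _ => (hext _).symm
    _ = _ := h1.trans h2.symm
    _ = _ := by
        congr 1
        exact Finset.sum_congr rfl fun H _ => hext H

/-! ### Functions of low degree in the values of `H` -/

/-- The linear span of the functions that depend on at most `k` values of `H`. -/
def lowDegree (X Y : Type*) (k : ℕ) : Submodule ℂ ((X → Y) → ℂ) :=
  Submodule.span ℂ {φ | ∃ S : Finset X, S.card ≤ k ∧ DependsOnlyOn S φ}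

theorem DependsOnlyOn.mem_lowDegree {X Y : Type*} {S : Finset X} {k : ℕ} {φ : (X → Y) → ℂ}
    (h : DependsOnlyOn S φ) (hS : S.card ≤ k) : φ ∈ lowDegree X Y k :=
  Submodule.subset_span ⟨S, hS, h⟩

theorem const_mem_lowDegree {X Y : Type*} (k : ℕ) (a : ℂ) : (fun _ => a) ∈ lowDegree X Y k :=
  DependsOnlyOn.mem_lowDegree (S := ∅) (fun _ _ _ => rfl) (by simp)

/-- On generators, the product depends on the union of the two sets; the rest is bilinearity. -/
theorem mul_mem_lowDegree {X Y : Type*} [DecidableEq X] {k l : ℕ} {φ χ : (X → Y) → ℂ}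
    (hφ : φ ∈ lowDegree X Y k) (hχ : χ ∈ lowDegree X Y l) :
    (fun H => φ H * χ H) ∈ lowDegree X Y (k + l) := by
  have h : φ * χ ∈ lowDegree X Y (k + l) := by
    refine Submodule.span_induction₂ (p := fun a b _ _ => a * b ∈ lowDegree X Y (k + l))
      ?_ ?_ ?_ ?_ ?_ ?_ ?_ hφ hχ
    · rintro a b ⟨S, hS, ha⟩ ⟨T, hT, hb⟩
      refine DependsOnlyOn.mem_lowDegree (S := S ∪ T) (fun H H' hH => ?_)
        ((Finset.card_union_le _ _).trans (add_le_add hS hT))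
      simp only [Pi.mul_apply]
      rw [ha H H' fun x hx => hH x (Finset.mem_union_left _ hx),
        hb H H' fun x hx => hH x (Finset.mem_union_right _ hx)]
    · intro b _
      simp
    · intro a _
      simp
    · intro a b c _ _ _ h1 h2
      rw [add_mul]
      exact add_mem h1 h2
    · intro a b c _ _ _ h1 h2
      rw [mul_add]
      exact add_mem h1 h2
    · intro r a b _ _ h1
      rw [smul_mul_assoc]
      exact Submodule.smul_mem _ _ h1
    · intro r a b _ _ h1
      rw [mul_smul_comm]
      exact Submodule.smul_mem _ _ h1
  exact h

theorem conj_mem_lowDegree {X Y : Type*} {k : ℕ} {φ : (X → Y) → ℂ} (hφ : φ ∈ lowDegree X Y k) :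
    (fun H => (starRingEnd ℂ) (φ H)) ∈ lowDegree X Y k := by
  refine Submodule.span_induction
    (p := fun a _ => (fun H => (starRingEnd ℂ) (a H)) ∈ lowDegree X Y k) ?_ ?_ ?_ ?_ hφ
  · rintro a ⟨S, hS, ha⟩
    exact DependsOnlyOn.mem_lowDegree (S := S) (fun H H' hH => by rw [ha H H' hH]) hS
  · simpa using const_mem_lowDegree k 0
  · intro a b _ _ h1 h2
    simp only [Pi.add_apply, map_add]
    exact add_mem h1 h2
  · intro r a _ h1
    simp only [Pi.smul_apply, smul_eq_mul, map_mul]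
    exact Submodule.smul_mem _ ((starRingEnd ℂ) r) h1

theorem sum_mem_lowDegree {X Y ι : Type*} {k : ℕ} (s : Finset ι) {φ : ι → (X → Y) → ℂ}
    (h : ∀ i ∈ s, φ i ∈ lowDegree X Y k) : (fun H => ∑ i ∈ s, φ i H) ∈ lowDegree X Y k := by
  have := sum_mem h
  convert this using 1
  ext H
  simp

theorem average_residueHash_lowDegree {X Y : Type*} [Fintype X] [DecidableEq X] [Fintype Y]
    [DecidableEq Y] [AddCommGroup Y] {e : X → ℕ} (he : Function.Injective e) {n k : ℕ}
    (hn : ∀ x, e x < 2 ^ n) {φ : (X → Y) → ℂ} (hφ : φ ∈ lowDegree X Y k) :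
    (∑ f : Fin (numModuli n k * numModuli n k) → Y,
        φ (residueHash e (numModuli n k) (tableCells f))) /
        Fintype.card (Fin (numModuli n k * numModuli n k) → Y) =
      (∑ H, φ H) / Fintype.card (X → Y) := by
  refine Submodule.span_induction (p := fun φ _ =>
    (∑ f : Fin (numModuli n k * numModuli n k) → Y,
        φ (residueHash e (numModuli n k) (tableCells f))) /
        (Fintype.card (Fin (numModuli n k * numModuli n k) → Y) : ℂ) =
      (∑ H, φ H) / Fintype.card (X → Y)) ?_ ?_ ?_ ?_ hφ
  · rintro φ ⟨S, hS, h⟩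
    exact average_residueHash he hn hS h
  · simp
  · intro a b _ _ h1 h2
    simp only [Pi.add_apply, Finset.sum_add_distrib, add_div, h1, h2]
  · intro r a _ h1
    simp only [Pi.smul_apply, smul_eq_mul, ← Finset.mul_sum, mul_div_assoc, h1]

/-! ### Runs with changing oracles -/

section Evolution

set_option linter.unusedSectionVars false

variable {X Y Z : Type*} [Fintype X] [DecidableEq X] [Fintype Y] [DecidableEq Y] [AddCommGroup Y]
  [Fintype Z] [DecidableEq Z] {q : ℕ}


theorem query_sub (H : X → Y) (ψ χ : Reg X Y Z → ℂ) :
    query H (ψ - χ) = query H ψ - query H χ := rfl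

/-- Projection of the query register to `|x₀⟩`. -/
def projX (x₀ : X) (ψ : Reg X Y Z → ℂ) : Reg X Y Z → ℂ := fun r => if r.2.1 = x₀ then ψ r else 0

/-- Both oracles act identically on basis states with x ≠ `x₀`, so only the projected part survives
in the difference. -/
theorem query_update_sub (H : X → Y) (x₀ : X) (θ : Y) (ψ : Reg X Y Z → ℂ) :
    query (Function.update H x₀ θ) ψ - query H ψ =
      query (Function.update H x₀ θ) (projX x₀ ψ) - query H (projX x₀ ψ) := by
  funext ⟨c, x, y, z⟩
  by_cases hx : x = x₀
  · simp [query, projX, hx]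
  · simp [query, projX, hx]

namespace OracleAlgorithm

theorem applyStep_sub (A : OracleAlgorithm X Y Z q) (j : ℕ) (ψ χ : Reg X Y Z → ℂ) :
    A.applyStep j (ψ - χ) = A.applyStep j ψ - A.applyStep j χ := by
  unfold applyStep
  split_ifs
  · exact Matrix.mulVec_sub _ _ _
  · rfl

/-- Continue the run in the state `ψ` before query `i`, the `j`-th of the following queries being
answered by the function `O j`. -/
def evolve (A : OracleAlgorithm X Y Z q) (O : ℕ → X → Y) (i : ℕ) (ψ : Reg X Y Z → ℂ) :
    ℕ → (Reg X Y Z → ℂ)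
  | 0 => ψ
  | j + 1 => A.applyStep (i + j) (query (O j) (A.evolve O i ψ j))

theorem state_eq_evolve (A : OracleAlgorithm X Y Z q) (H : X → Y) (m : ℕ) :
    A.state H m = A.evolve (fun _ => H) 0 A.start m := by
  induction m with
  | zero => rfl
  | succ m ih => simp [state, evolve, ih]

theorem evolve_succ (A : OracleAlgorithm X Y Z q) (O : ℕ → X → Y) (i : ℕ) (ψ : Reg X Y Z → ℂ)
    (m : ℕ) : A.evolve O i ψ (m + 1) =
      A.evolve (fun j => O (j + 1)) (i + 1) (A.applyStep i (query (O 0) ψ)) m := by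
  induction m with
  | zero => rfl
  | succ m ih =>
    rw [evolve, ih, evolve]
    congr 1
    omega

theorem evolve_sub (A : OracleAlgorithm X Y Z q) (O : ℕ → X → Y) (i : ℕ) (ψ χ : Reg X Y Z → ℂ)
    (m : ℕ) : A.evolve O i (ψ - χ) m = A.evolve O i ψ m - A.evolve O i χ m := by
  induction m with
  | zero => rfl
  | succ m ih => rw [evolve, ih, query_sub, applyStep_sub]; rfl

/-- The final state if query `i` is measured with outcome `x₀`, and `H` is reprogrammed to `θ` at
`x₀` from this query on (`b ≠ 0`) or from the next query on (`b = 0`). -/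
def reprogrammed (A : OracleAlgorithm X Y Z q) (H : X → Y) (x₀ : X) (θ : Y) (i b : ℕ) :
    Reg X Y Z → ℂ :=
  A.evolve (fun j => if b + j ≠ 0 then Function.update H x₀ θ else H) i
    (projX x₀ (A.state H i)) (q - i)

/-- The hybrid after i replacements answers the first i queries by H and the others by the
reprogrammed function. The sum telescopes the changes between hybrids. -/
theorem state_update_eq (A : OracleAlgorithm X Y Z q) (H : X → Y) (x₀ : X) (θ : Y) {i : ℕ}
    (hi : i ≤ q) : A.state (Function.update H x₀ θ) q =
      A.evolve (fun _ => Function.update H x₀ θ) i (A.state H i) (q - i) +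
        ∑ k ∈ range i, (A.reprogrammed H x₀ θ k 1 - A.reprogrammed H x₀ θ k 0) := by
  induction i with
  | zero => simp [state_eq_evolve, evolve]
  | succ i ih =>
    rw [ih (by omega), Finset.sum_range_succ]
    obtain ⟨m, hm⟩ : ∃ m, q - i = m + 1 := ⟨q - i - 1, by omega⟩
    have hm' : q - (i + 1) = m := by omega
    -- The two hybrids continue identically after query i, so by linearity their difference is the
    -- continuation of the difference at query i, to which `query_update_sub` applies.
    have h : A.reprogrammed H x₀ θ i 1 - A.reprogrammed H x₀ θ i 0 =
        A.evolve (fun _ => Function.update H x₀ θ) i (A.state H i) (q - i) -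
        A.evolve (fun _ => Function.update H x₀ θ) (i + 1) (A.state H (i + 1)) (q - (i + 1)) := by
      unfold reprogrammed
      rw [hm', hm, evolve_succ, evolve_succ, evolve_succ, state]
      simp only [ne_eq, Nat.add_eq_zero_iff, one_ne_zero, and_false, not_false_eq_true,
        if_true, add_zero, not_true_eq_false, if_false]
      rw [← evolve_sub, ← evolve_sub, ← applyStep_sub, ← applyStep_sub, ← query_update_sub]
    rw [h]
    abel

/-! ### Degrees -/

/-- A new amplitude is a sum over y' of old amplitudes times the indicator that the oracle's answer
leads from y' to y. The indicator depends on H at the single point x, so a query raises the degree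
by one. -/
theorem query_mem_lowDegree {k : ℕ} {ψ : (X → Y) → Reg X Y Z → ℂ}
    (hψ : ∀ r, (fun H => ψ H r) ∈ lowDegree X Y k) {O : (X → Y) → X → Y}
    (hO : ∀ x, DependsOnlyOn {x} fun H => O H x) (r : Reg X Y Z) :
    (fun H => query (O H) (ψ H) r) ∈ lowDegree X Y (k + 1) := by
  obtain ⟨c, x, y, z⟩ := r
  have : (fun H => query (O H) (ψ H) (c, x, y, z)) = fun H => ∑ y' : Y,
      ψ H (c, x, y', z) * if y' = y - (if c then O H x else 0) then 1 else 0 := by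
    funext H
    simp [query]
  rw [this]
  refine sum_mem_lowDegree _ fun y' _ => mul_mem_lowDegree (hψ _) ?_
  exact DependsOnlyOn.mem_lowDegree (S := {x}) (fun H H' h => by
    have hx : O H x = O H' x := hO x H H' h
    simp only [hx]) (by simp)

theorem applyStep_mem_lowDegree (A : OracleAlgorithm X Y Z q) {k : ℕ}
    {ψ : (X → Y) → Reg X Y Z → ℂ} (hψ : ∀ r, (fun H => ψ H r) ∈ lowDegree X Y k) (j : ℕ)
    (r : Reg X Y Z) : (fun H => A.applyStep j (ψ H) r) ∈ lowDegree X Y k := by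
  unfold applyStep
  split_ifs with h
  · simp only [Matrix.mulVec, dotProduct]
    exact sum_mem_lowDegree _ fun r' _ => Submodule.smul_mem _ _ (hψ r')
  · exact hψ r

theorem evolve_mem_lowDegree (A : OracleAlgorithm X Y Z q) {k : ℕ}
    {ψ : (X → Y) → Reg X Y Z → ℂ} (hψ : ∀ r, (fun H => ψ H r) ∈ lowDegree X Y k)
    {O : (X → Y) → ℕ → X → Y} (hO : ∀ j x, DependsOnlyOn {x} fun H => O H j x) (i m : ℕ)
    (r : Reg X Y Z) : (fun H => A.evolve (O H) i (ψ H) m r) ∈ lowDegree X Y (k + m) := by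
  induction m generalizing r with
  | zero => exact hψ r
  | succ m ih =>
    exact A.applyStep_mem_lowDegree (query_mem_lowDegree ih fun x => hO m x) _ r

/-- Since `x₀` and `θ` are fixed, the reprogrammed function at x still depends on H x at most, and
the degree is i + (q - i). -/
theorem reprogrammed_mem_lowDegree (A : OracleAlgorithm X Y Z q) (x₀ : X) (θ : Y) {i : ℕ}
    (hi : i ≤ q) (b : ℕ) (r : Reg X Y Z) :
    (fun H => A.reprogrammed H x₀ θ i b r) ∈ lowDegree X Y q := by
  have hst : ∀ r, (fun H => projX x₀ (A.state H i) r) ∈ lowDegree X Y i := by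
    intro r
    unfold projX
    split_ifs with h
    · simp only [state_eq_evolve]
      have := A.evolve_mem_lowDegree (k := 0) (ψ := fun _ => A.start) (O := fun H _ => H)
        (fun r => const_mem_lowDegree 0 _) (fun j x H H' h => h x (by simp)) 0 i r
      rwa [zero_add] at this
    · exact const_mem_lowDegree _ _
  have := A.evolve_mem_lowDegree hst
    (O := fun H j => if b + j ≠ 0 then Function.update H x₀ θ else H)
    (fun j x H H' h => by
      have hx := h x (by simp)
      dsimp only
      split_ifs
      · simp only [Function.update_apply, hx]
      · exact hx) i (q - i) r
  rwa [show i + (q - i) = q by omega] at this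

end OracleAlgorithm

/-! ### Success probabilities -/

/-- Probability that the register `Z` of the (subnormalized) state `ψ` satisfies `P`. -/
noncomputable def successProb (P : Matrix Z Z ℂ) (ψ : Reg X Y Z → ℂ) : ℝ :=
  ∑ c : Bool, ∑ x : X, ∑ y : Y, sqNorm (P.mulVec fun z => ψ (c, x, y, z))

/-- A squared modulus is an amplitude times its conjugate, whence the doubled degree. -/
theorem successProb_mem_lowDegree (P : Matrix Z Z ℂ) {k : ℕ} {ψ : (X → Y) → Reg X Y Z → ℂ}
    (hψ : ∀ r, (fun H => ψ H r) ∈ lowDegree X Y k) :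
    (fun H => (successProb P (ψ H) : ℂ)) ∈ lowDegree X Y (2 * k) := by
  simp only [successProb, sqNorm, Complex.ofReal_sum]
  refine sum_mem_lowDegree _ fun c _ => sum_mem_lowDegree _ fun x _ => sum_mem_lowDegree _
    fun y _ => sum_mem_lowDegree _ fun z _ => ?_
  have h : (fun H => (P.mulVec fun z => ψ H (c, x, y, z)) z) ∈ lowDegree X Y k := by
    simp only [Matrix.mulVec, dotProduct]
    exact sum_mem_lowDegree _ fun z' _ => Submodule.smul_mem _ _ (hψ _)
  have h2 := mul_mem_lowDegree h (conj_mem_lowDegree h)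
  rw [← two_mul] at h2
  convert h2 using 1
  funext H
  rw [Complex.mul_conj, Complex.normSq_eq_norm_sq]

theorem average_successProb_residueHash {e : X → ℕ} (he : Function.Injective e) {n k : ℕ}
    (hn : ∀ x, e x < 2 ^ n) (P : Matrix Z Z ℂ) {ψ : (X → Y) → Reg X Y Z → ℂ}
    (hψ : ∀ r, (fun H => ψ H r) ∈ lowDegree X Y k) :
    (∑ f : Fin (numModuli n (2 * k) * numModuli n (2 * k)) → Y,
        successProb P (ψ (residueHash e (numModuli n (2 * k)) (tableCells f)))) /
        Fintype.card (Fin (numModuli n (2 * k) * numModuli n (2 * k)) → Y) =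
      (∑ H, successProb P (ψ H)) / Fintype.card (X → Y) := by
  have := average_residueHash_lowDegree he hn (successProb_mem_lowDegree P hψ)
  apply Complex.ofReal_injective
  push_cast
  exact this

/-- The index encodes the run: 2k + b stands for query k with reprogramming bit b, and 2m for the
measured output. Each index occurs exactly once on the left. -/
theorem norm_add_sum_sub_le (t : ℕ → ℂ) (m : ℕ) :
    ‖t (2 * m) + ∑ k ∈ range m, (t (2 * k + 1) - t (2 * k))‖ ≤
      ∑ r ∈ range (2 * m + 1), ‖t r‖ := by
  have h : ‖∑ k ∈ range m, (t (2 * k + 1) - t (2 * k))‖ ≤ ∑ r ∈ range (2 * m), ‖t r‖ := by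
    induction m with
    | zero => simp
    | succ m ih =>
      rw [Finset.sum_range_succ, show 2 * (m + 1) = 2 * m + 1 + 1 by ring, Finset.sum_range_succ,
        Finset.sum_range_succ]
      have h1 := norm_add_le (∑ k ∈ range m, (t (2 * k + 1) - t (2 * k)))
        (t (2 * m + 1) - t (2 * m))
      have h2 := norm_sub_le (t (2 * m + 1)) (t (2 * m))
      linarith
  rw [Finset.sum_range_succ]
  have := norm_add_le (t (2 * m)) (∑ k ∈ range m, (t (2 * k + 1) - t (2 * k)))
  linarith

theorem OracleAlgorithm.sqNorm_state_update_le (A : OracleAlgorithm X Y Z q) (H : X → Y) (x₀ : X)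
    (θ : Y) (P : Matrix Z Z ℂ) :
    ∑ c : Bool, ∑ y : Y,
        sqNorm (P.mulVec fun z => A.state (Function.update H x₀ θ) q (c, x₀, y, z)) ≤
      (2 * q + 1) * ∑ r ∈ range (2 * q + 1),
        successProb P (A.reprogrammed H x₀ θ (r / 2) (r % 2)) := by
  set t : ℕ → Reg X Y Z → ℂ := fun r => A.reprogrammed H x₀ θ (r / 2) (r % 2)
  -- At i = q no query is left, so the leading term is the final state under H. Its part at `x₀` is
  -- the run with index 2q, in which the output is measured.
  have hstate : ∀ c y z, A.state (Function.update H x₀ θ) q (c, x₀, y, z) =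
      t (2 * q) (c, x₀, y, z) +
        ∑ k ∈ range q, (t (2 * k + 1) (c, x₀, y, z) - t (2 * k) (c, x₀, y, z)) := by
    intro c y z
    rw [A.state_update_eq H x₀ θ le_rfl]
    have h1 : ∀ k, (2 * k + 1) / 2 = k := fun k => by omega
    have h2 : ∀ k, (2 * k + 1) % 2 = 1 := fun k => by omega
    simp [t, h1, h2, reprogrammed, evolve, projX]
  have hpt : ∀ (c : Bool) (y : Y) (z : Z),
      ‖(P.mulVec fun z => A.state (Function.update H x₀ θ) q (c, x₀, y, z)) z‖ ^ 2 ≤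
        (2 * q + 1) * ∑ r ∈ range (2 * q + 1),
          ‖(P.mulVec fun z => t r (c, x₀, y, z)) z‖ ^ 2 := by
    intro c y z
    set a : ℕ → ℂ := fun r => (P.mulVec fun z => t r (c, x₀, y, z)) z
    have ha : (P.mulVec fun z => A.state (Function.update H x₀ θ) q (c, x₀, y, z)) z =
        a (2 * q) + ∑ k ∈ range q, (a (2 * k + 1) - a (2 * k)) := by
      simp only [a, hstate, Matrix.mulVec, dotProduct, mul_add, Finset.mul_sum,
        Finset.sum_add_distrib, ← Finset.sum_sub_distrib, ← mul_sub]
      rw [Finset.sum_comm]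
    -- The triangle inequality, then Cauchy–Schwarz for 2q+1 terms.
    rw [ha]
    calc _ ≤ (∑ r ∈ range (2 * q + 1), ‖a r‖) ^ 2 :=
          pow_le_pow_left₀ (norm_nonneg _) (norm_add_sum_sub_le a q) 2
      _ ≤ _ := by
          have := sq_sum_le_card_mul_sum_sq (s := range (2 * q + 1)) (f := fun r => ‖a r‖)
          simpa using this
  calc _ ≤ ∑ c : Bool, ∑ y : Y, ∑ z : Z, (2 * q + 1) * ∑ r ∈ range (2 * q + 1),
          ‖(P.mulVec fun z => t r (c, x₀, y, z)) z‖ ^ 2 :=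
        Finset.sum_le_sum fun c _ => Finset.sum_le_sum fun y _ => Finset.sum_le_sum fun z _ =>
          hpt c y z
    _ = (2 * q + 1) * ∑ r ∈ range (2 * q + 1), ∑ c : Bool, ∑ y : Y,
          sqNorm (P.mulVec fun z => t r (c, x₀, y, z)) := by
        simp only [← Finset.mul_sum, sqNorm]
        congr 1
        symm
        rw [Finset.sum_comm]
        refine Finset.sum_congr rfl fun c _ => ?_
        rw [Finset.sum_comm]
        refine Finset.sum_congr rfl fun y _ => ?_
        rw [Finset.sum_comm]
    _ ≤ _ := by
        refine mul_le_mul_of_nonneg_left (Finset.sum_le_sum fun r _ => ?_) (by positivity)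
        refine Finset.sum_le_sum fun c _ => ?_
        refine Finset.single_le_sum (f := fun x => ∑ y : Y,
          sqNorm (P.mulVec fun z => t r (c, x, y, z))) (fun x _ => ?_) (Finset.mem_univ x₀)
        exact Finset.sum_nonneg fun y _ => Finset.sum_nonneg fun z _ => by positivity

/-- Exchanging `θ` with the value of H at `x₀` is an involution of the pairs (H, θ). -/
theorem sum_update_eq (x₀ : X) (G : (X → Y) → ℝ) :
    ∑ θ : Y, ∑ H : X → Y, G (Function.update H x₀ θ) = Fintype.card Y * ∑ H, G H := by
  let swap : (X → Y) × Y → (X → Y) × Y := fun p => (Function.update p.1 x₀ p.2, p.1 x₀)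
  have hswap : Function.Involutive swap := fun p => by simp [swap]
  have h := Equiv.sum_comp hswap.toPerm fun p => G p.1
  simp only [Fintype.sum_prod_type] at h
  rw [Finset.sum_comm]
  refine Eq.trans ?_ (h.trans ?_)
  · rfl
  · simp [← Finset.mul_sum]

theorem OracleAlgorithm.winProb_le (A : OracleAlgorithm X Y Z q) (x₀ : X)
    (V : X → Y → Matrix Z Z ℂ) :
    A.winProb x₀ V / (2 * q + 1) ^ 2 ≤
      (∑ r ∈ range (2 * q + 1), ∑ θ : Y,
        (∑ H, successProb (V x₀ θ) (A.reprogrammed H x₀ θ (r / 2) (r % 2))) /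
          Fintype.card (X → Y)) / Fintype.card Y / (2 * q + 1) := by
  set W := ∑ H : X → Y, ∑ c : Bool, ∑ y : Y,
    sqNorm ((V x₀ (H x₀)).mulVec fun z => A.state H q (c, x₀, y, z)) with hW
  set T := ∑ r ∈ range (2 * q + 1), ∑ θ : Y,
    ∑ H, successProb (V x₀ θ) (A.reprogrammed H x₀ θ (r / 2) (r % 2)) with hT
  -- Write the uniform function as `Function.update H x₀ θ`, whose value at `x₀` is `θ`, and apply
  -- the pointwise bound to each pair.
  have hmain : Fintype.card Y * W ≤ (2 * q + 1) * T := by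
    rw [hT, Finset.sum_comm (s := range (2 * q + 1)), hW, ← sum_update_eq x₀, Finset.mul_sum]
    refine Finset.sum_le_sum fun θ _ => ?_
    rw [Finset.sum_comm (s := range (2 * q + 1)), Finset.mul_sum]
    refine Finset.sum_le_sum fun H _ => ?_
    simpa using A.sqNorm_state_update_le H x₀ θ (V x₀ θ)
  have hY : (0 : ℝ) < Fintype.card Y := Nat.cast_pos.2 Fintype.card_pos
  have hXY : (0 : ℝ) < Fintype.card (X → Y) := Nat.cast_pos.2 Fintype.card_pos
  have hq : (0 : ℝ) < 2 * q + 1 := by positivity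
  simp only [← Finset.sum_div]
  rw [← hT, winProb, ← hW, div_div, div_div, div_div, div_le_div_iff₀ (by positivity)
    (by positivity)]
  have := mul_le_mul_of_nonneg_left hmain
    (show (0 : ℝ) ≤ Fintype.card (X → Y) * (2 * q + 1) by positivity)
  nlinarith

end Evolution

/-! ### A program logic for programs without branching -/

/-- All variables of the expression have numbers below `m`. -/
def Expr.VarsLT (m : ℕ) : Expr → Prop
  | .const _ => True
  | .var i => i < m
  | .add a b => a.VarsLT m ∧ b.VarsLT m
  | .sub a b => a.VarsLT m ∧ b.VarsLT m
  | .mul a b => a.VarsLT m ∧ b.VarsLT m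
  | .div a b => a.VarsLT m ∧ b.VarsLT m
  | .mod a b => a.VarsLT m ∧ b.VarsLT m

theorem Expr.eval_congr {m : ℕ} {σ τ : ℕ → ℕ} (h : ∀ i < m, σ i = τ i) {e : Expr}
    (he : e.VarsLT m) : e.eval σ = e.eval τ := by
  induction e with
  | const n => rfl
  | var i => exact h i he
  | add a b iha ihb | sub a b iha ihb | mul a b iha ihb | div a b iha ihb | mod a b iha ihb =>
    simp only [Expr.eval, iha he.1, ihb he.2]

theorem Expr.VarsLT.mono {m m' : ℕ} (h : m ≤ m') {e : Expr} (he : e.VarsLT m) : e.VarsLT m' := by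
  induction e with
  | const n => trivial
  | var i => exact lt_of_lt_of_le he h
  | add a b iha ihb | sub a b iha ihb | mul a b iha ihb | div a b iha ihb | mod a b iha ihb =>
    exact ⟨iha he.1, ihb he.2⟩

theorem flipIf_flipIf_self (b b' : Bool) (t : ℕ) (w : Finset ℕ) :
    flipIf b t (flipIf b' t w) = flipIf (b ^^ b') t w := by
  cases b <;> cases b' <;> simp [flipIf]

theorem flipIf_comm (b b' : Bool) (t t' : ℕ) (w : Finset ℕ) :
    flipIf b t (flipIf b' t' w) = flipIf b' t' (flipIf b t w) := by
  cases b <;> cases b' <;> simp [flipIf, symmDiff_assoc, symmDiff_comm {t} {t'}]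

theorem flipIf_false (t : ℕ) (w : Finset ℕ) : flipIf false t w = w := rfl

theorem mem_flipIf_of_ne {b : Bool} {t u : ℕ} {w : Finset ℕ} (h : u ≠ t) :
    u ∈ flipIf b t w ↔ u ∈ w := by
  cases b <;> simp [flipIf, Finset.mem_symmDiff, h]

theorem mem_flipIf_self {b : Bool} {t : ℕ} {w : Finset ℕ} (h : t ∉ w) :
    t ∈ flipIf b t w ↔ b = true := by
  cases b <;> simp [flipIf, Finset.mem_symmDiff, h]

theorem flipIf_eq_iff {b : Bool} {t : ℕ} {w w' : Finset ℕ} :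
    flipIf b t w = w' ↔ w = flipIf b t w' := by
  constructor
  · rintro rfl
    simp [flipIf_flipIf_self, flipIf_false]
  · rintro rfl
    simp [flipIf_flipIf_self, flipIf_false]

/-- The components of a branch other than variables, time and quantum state. -/
structure Frame (X Y : Type*) where
  cells : ℕ → Y
  out : Option X
  pos : ℕ
  prob : ℝ

section Logic

set_option linter.unusedSectionVars false

variable {X Y Z : Type*} [Fintype X] [DecidableEq X] [Fintype Y] [DecidableEq Y] [AddCommGroup Y]
  [Fintype Z] [DecidableEq Z] {q : ℕ}

/-- Joint state in which the work qubits are in the basis state `W c x`. -/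
def ketOf (W : Bool → X → Finset ℕ) (ψ : Reg X Y Z → ℂ) : Finset ℕ → Reg X Y Z → ℂ :=
  fun w r => if w = W r.1 r.2.1 then ψ r else 0

/-- The branch `s` has the given components; of its variables, only those below `m` matter. -/
structure Realizes (m : ℕ) (σ : ℕ → ℕ) (F : Frame X Y) (W : Bool → X → Finset ℕ)
    (ψ : Reg X Y Z → ℂ) (s : Branch X Y Z) : Prop where
  vars : ∀ i < m, s.vars i = σ i
  cells : s.cells = F.cells
  out : s.out = F.out
  pos : s.pos = F.pos
  prob : s.prob = F.prob
  ket : s.ket = ketOf W ψ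

theorem Realizes.eval {m : ℕ} {σ : ℕ → ℕ} {F : Frame X Y} {W : Bool → X → Finset ℕ}
    {ψ : Reg X Y Z → ℂ} {s : Branch X Y Z} (h : Realizes m σ F W ψ s) {e : Expr}
    (he : e.VarsLT m) : e.eval s.vars = e.eval σ :=
  Expr.eval_congr h.vars he

theorem Realizes.tick {m : ℕ} {σ : ℕ → ℕ} {F : Frame X Y} {W : Bool → X → Finset ℕ}
    {ψ : Reg X Y Z → ℂ} {s : Branch X Y Z} (h : Realizes m σ F W ψ s) (n : ℕ) :
    Realizes m σ F W ψ (s.tick n) :=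
  ⟨h.vars, h.cells, h.out, h.pos, h.prob, h.ket⟩

theorem Realizes.setVar {m : ℕ} {σ : ℕ → ℕ} {F : Frame X Y} {W : Bool → X → Finset ℕ}
    {ψ : Reg X Y Z → ℂ} {s : Branch X Y Z} (h : Realizes m σ F W ψ s) (n : ℕ) :
    Realizes (m + 1) (Function.update σ m n) F W ψ (s.setVar m n) := by
  refine ⟨fun i hi => ?_, h.cells, h.out, h.pos, h.prob, h.ket⟩
  by_cases him : i = m
  · subst him
    simp [Branch.setVar]
  · simp [Branch.setVar, him, h.vars i (by omega)]

theorem Realizes.weaken {m : ℕ} {σ : ℕ → ℕ} {F : Frame X Y} {W : Bool → X → Finset ℕ}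
    {ψ : Reg X Y Z → ℂ} {s : Branch X Y Z} {n : ℕ}
    (h : Realizes (m + 1) (Function.update σ m n) F W ψ s) : Realizes m σ F W ψ s := by
  refine ⟨fun i hi => ?_, h.cells, h.out, h.pos, h.prob, h.ket⟩
  rw [h.vars i (by omega), Function.update_of_ne (by omega)]

/-- The program `p` has a single branch, and changes the components as indicated. -/
def Triple (enc : X ↪ Fin (2 ^ bits X)) (A : OracleAlgorithm X Y Z q) (m : ℕ) (σ : ℕ → ℕ)
    (F : Frame X Y) (W : Bool → X → Finset ℕ) (ψ : Reg X Y Z → ℂ) (p : Prog)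
    (F' : Frame X Y) (W' : Bool → X → Finset ℕ) (ψ' : Reg X Y Z → ℂ) : Prop :=
  ∀ s, Realizes m σ F W ψ s → ∃ s', run enc A p s = {s'} ∧ Realizes m σ F' W' ψ' s'

variable {enc : X ↪ Fin (2 ^ bits X)} {A : OracleAlgorithm X Y Z q} {m : ℕ} {σ : ℕ → ℕ}
  {F F' F'' : Frame X Y} {W W' W'' : Bool → X → Finset ℕ} {ψ ψ' ψ'' : Reg X Y Z → ℂ}
  {p p' : Prog}

namespace Triple

theorem skip : Triple enc A m σ F W ψ .skip F W ψ := fun s h => ⟨s, by simp [run], h⟩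

theorem seq (h : Triple enc A m σ F W ψ p F' W' ψ')
    (h' : Triple enc A m σ F' W' ψ' p' F'' W'' ψ'') :
    Triple enc A m σ F W ψ (.seq p p') F'' W'' ψ'' := by
  intro s hs
  obtain ⟨s', hr, hs'⟩ := h s hs
  obtain ⟨s'', hr', hs''⟩ := h' s' hs'
  exact ⟨s'', by simp [run, hr, hr'], hs''⟩

theorem congr_right (h : Triple enc A m σ F W ψ p F W' ψ') (hW : ∀ c x, W' c x = W'' c x)
    (hψ : ψ' = ψ'') : Triple enc A m σ F W ψ p F W'' ψ'' := by
  have : W' = W'' := funext fun c => funext fun x => hW c x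
  rwa [← this, ← hψ]

theorem ite {e : Expr} (he : e.VarsLT m)
    (h : e.eval σ ≠ 0 → Triple enc A m σ F W ψ p F' W' ψ')
    (h' : e.eval σ = 0 → Triple enc A m σ F W ψ p' F' W' ψ') :
    Triple enc A m σ F W ψ (.ite e p p') F' W' ψ' := by
  intro s hs
  simp only [run, hs.eval he]
  split_ifs with hc
  · exact h hc _ (hs.tick _)
  · exact h' (by simpa using hc) _ (hs.tick _)

/-- The families indexed by k are the loop invariant. The counter is variable m, the first one not
tracked outside, so its final value need not be described. -/
theorem loop {e : Expr} (he : e.VarsLT m) (F : ℕ → Frame X Y) (W : ℕ → Bool → X → Finset ℕ)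
    (ψ : ℕ → Reg X Y Z → ℂ)
    (h : ∀ k < e.eval σ, Triple enc A (m + 1) (Function.update σ m k) (F k) (W k) (ψ k) p
      (F (k + 1)) (W (k + 1)) (ψ (k + 1))) :
    Triple enc A m σ (F 0) (W 0) (ψ 0) (.loop m e p) (F (e.eval σ)) (W (e.eval σ))
      (ψ (e.eval σ)) := by
  intro s hs
  simp only [run, hs.eval he]
  have key : ∀ n ≤ e.eval σ, ∃ s', Nat.rec (motive := fun _ => Multiset (Branch X Y Z))
      {s.tick (1 + e.cost s.vars)} (fun k L => L.bind fun s' =>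
        run enc A p ((s'.setVar m k).tick (1 + m.size + k.size))) n = {s'} ∧
      Realizes m σ (F n) (W n) (ψ n) s' := by
    intro n
    induction n with
    | zero => exact fun _ => ⟨_, rfl, hs.tick _⟩
    | succ n ih =>
      intro hn
      obtain ⟨s', hr, hs'⟩ := ih (by omega)
      obtain ⟨s'', hr', hs''⟩ := h n (by omega) _ ((hs'.setVar n).tick (1 + m.size + n.size))
      exact ⟨s'', by simp only [hr, Multiset.singleton_bind, hr'], hs''.weaken⟩
  exact key _ le_rfl

/-- A gate is described by its pullback on amplitudes. As `flipIf` is an involution, this equals a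
flip of the basis state itself. -/
theorem of_gate {g : Bool → X → Bool} {t : ℕ} (hrun : ∀ s, Realizes m σ F W ψ s →
    ∃ n, run enc A p s =
      {(s.setKet fun w r => ketOf W ψ (flipIf (g r.1 r.2.1) t w) r).tick n}) :
    Triple enc A m σ F W ψ p F (fun c x => flipIf (g c x) t (W c x)) ψ := by
  intro s hs
  obtain ⟨n, hr⟩ := hrun s hs
  refine ⟨_, hr, hs.vars, hs.cells, hs.out, hs.pos, hs.prob, ?_⟩
  funext w r
  simp only [Branch.tick, Branch.setKet, ketOf, flipIf_eq_iff]

theorem flip {t : Expr} (ht : t.VarsLT m) :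
    Triple enc A m σ F W ψ (.flip t) F (fun c x => flipIf true (t.eval σ) (W c x)) ψ :=
  of_gate fun s hs => ⟨_, by simp only [run, hs.eval ht, hs.ket]; rfl⟩

theorem readC {t : Expr} (ht : t.VarsLT m) :
    Triple enc A m σ F W ψ (.readC t) F (fun c x => flipIf c (t.eval σ) (W c x)) ψ :=
  of_gate fun s hs => ⟨_, by simp only [run, hs.eval ht, hs.ket]; rfl⟩

theorem readX {k t : Expr} (hk : k.VarsLT m) (ht : t.VarsLT m) :
    Triple enc A m σ F W ψ (.readX k t) F
      (fun c x => flipIf ((enc x).val.testBit (k.eval σ)) (t.eval σ) (W c x)) ψ :=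
  of_gate fun s hs => ⟨_, by simp only [run, hs.eval ht, hs.eval hk, hs.ket]; rfl⟩

theorem readOut {k t : Expr} (hk : k.VarsLT m) (ht : t.VarsLT m) :
    Triple enc A m σ F W ψ (.readOut k t) F
      (fun c x => flipIf (F.out.any fun x => (enc x).val.testBit (k.eval σ)) (t.eval σ) (W c x))
      ψ :=
  of_gate fun s hs => ⟨_, by simp only [run, hs.eval ht, hs.eval hk, hs.ket, hs.out]; rfl⟩

/-- Flipping the target leaves the controls alone, so they may be read before or after the flip. -/
theorem toffoli {a b t : Expr} (ha : a.VarsLT m) (hb : b.VarsLT m) (ht : t.VarsLT m)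
    (hat : a.eval σ ≠ t.eval σ) (hbt : b.eval σ ≠ t.eval σ) :
    Triple enc A m σ F W ψ (.toffoli a b t) F
      (fun c x => flipIf (decide (a.eval σ ∈ W c x) && decide (b.eval σ ∈ W c x)) (t.eval σ)
        (W c x)) ψ := by
  intro s hs
  refine ⟨_, rfl, hs.vars, hs.cells, hs.out, hs.pos, hs.prob, ?_⟩
  funext w r
  simp only [Branch.tick, Branch.setKet, ketOf, hs.ket, hs.eval ha, hs.eval hb, hs.eval ht]
  congr 1
  simp only [ne_eq, hat.symm, not_false_eq_true, hbt.symm, and_true, Bool.decide_and, eq_iff_iff]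
  rw [flipIf_eq_iff]
  constructor
  · intro h
    have h1 : a.eval σ ∈ w ↔ a.eval σ ∈ W r.1 r.2.1 := by
      rw [h, mem_flipIf_of_ne hat]
    have h2 : b.eval σ ∈ w ↔ b.eval σ ∈ W r.1 r.2.1 := by
      rw [h, mem_flipIf_of_ne hbt]
    simp only [h1, h2] at h
    exact h
  · intro h
    have h1 : a.eval σ ∈ w ↔ a.eval σ ∈ W r.1 r.2.1 := by
      rw [h, mem_flipIf_of_ne hat]
    have h2 : b.eval σ ∈ w ↔ b.eval σ ∈ W r.1 r.2.1 := by
      rw [h, mem_flipIf_of_ne hbt]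
    simp only [h1, h2]
    exact h

end Triple

/-- Add `g c x` to the response register. -/
def shiftY (g : Bool → X → Y) (ψ : Reg X Y Z → ℂ) : Reg X Y Z → ℂ :=
  fun (c, x, y, z) => ψ (c, x, y - g c x, z)

theorem shiftY_shiftY (g g' : Bool → X → Y) (ψ : Reg X Y Z → ℂ) :
    shiftY g (shiftY g' ψ) = shiftY (fun c x => g c x + g' c x) ψ := by
  funext ⟨c, x, y, z⟩
  simp [shiftY, sub_sub]

theorem shiftY_zero (ψ : Reg X Y Z → ℂ) : shiftY (fun _ _ => 0) ψ = ψ := by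
  funext ⟨c, x, y, z⟩
  simp [shiftY]

theorem query_eq_shiftY (H : X → Y) (ψ : Reg X Y Z → ℂ) :
    query H ψ = shiftY (fun c x => if c then H x else 0) ψ := rfl

namespace Triple

theorem addY {a t : Expr} (ha : a.VarsLT m) (ht : t.VarsLT m) :
    Triple enc A m σ F W ψ (.addY a t) F W
      (shiftY (fun c x => if t.eval σ ∈ W c x then F.cells (a.eval σ) else 0) ψ) := by
  intro s hs
  refine ⟨_, rfl, hs.vars, hs.cells, hs.out, hs.pos, hs.prob, ?_⟩
  funext w ⟨c, x, y, z⟩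
  simp only [Branch.tick, Branch.setKet, ketOf, hs.ket, hs.eval ha, hs.eval ht, hs.cells, shiftY]
  by_cases h : w = W c x
  · simp [h]
  · simp [h]

/-- The work qubits have to be uncomputed first: an operation of `A` mixes values of c and x, after
which qubits depending on them would no longer have the form `ketOf`. -/
theorem call : Triple enc A m σ F (fun _ _ => ∅) ψ .call
    { F with pos := F.pos + 1 } (fun _ _ => ∅) (A.applyStep F.pos ψ) := by
  intro s hs
  refine ⟨_, rfl, hs.vars, hs.cells, hs.out, by simp [Branch.tick, Branch.setKet, hs.pos],
    hs.prob, ?_⟩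
  funext w
  have hzero : A.applyStep s.pos (fun _ => 0) = fun _ => 0 := by
    unfold OracleAlgorithm.applyStep
    split_ifs
    · exact Matrix.mulVec_zero _
    · rfl
  have hket : ∀ χ : Reg X Y Z → ℂ,
      ketOf (fun _ _ => ∅) χ w = if w = ∅ then χ else fun _ => 0 := by
    intro χ
    funext r
    by_cases h : w = ∅ <;> simp [ketOf, h]
  simp only [Branch.tick, Branch.setKet, hs.ket, hket]
  by_cases h : w = ∅
  · simp [h, hs.pos]
  · simp [h, hzero]

end Triple

end Logic

/-! ### Sets of qubits -/

/-- Flip the qubits `t 0, …, t k` under the conditions `b 0, …, b k`. -/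
def flipChain (b : ℕ → Bool) (t : ℕ → ℕ) (w : Finset ℕ) : ℕ → Finset ℕ
  | 0 => flipIf (b 0) (t 0) w
  | k + 1 => flipIf (b (k + 1)) (t (k + 1)) (flipChain b t w k)

theorem mem_flipChain_of_ne {b : ℕ → Bool} {t : ℕ → ℕ} {w : Finset ℕ} {u k : ℕ}
    (h : ∀ j ≤ k, u ≠ t j) : u ∈ flipChain b t w k ↔ u ∈ w := by
  induction k with
  | zero => exact mem_flipIf_of_ne (h 0 le_rfl)
  | succ k ih =>
    exact (mem_flipIf_of_ne (h _ le_rfl)).trans (ih fun j hj => h j (by omega))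

theorem mem_flipChain_self {b : ℕ → Bool} {t : ℕ → ℕ} {w : Finset ℕ} {j k : ℕ}
    (ht : ∀ i j, t i = t j → i = j) (hw : ∀ j, t j ∉ w) (hj : j ≤ k) :
    t j ∈ flipChain b t w k ↔ b j = true := by
  induction k with
  | zero =>
    obtain rfl : j = 0 := by omega
    exact mem_flipIf_self (hw 0)
  | succ k ih =>
    by_cases hjk : j = k + 1
    · subst hjk
      refine mem_flipIf_self fun hmem =>
        hw (k + 1) ((mem_flipChain_of_ne fun i hi heq => ?_).1 hmem)
      have := ht _ _ heq
      omega
    · exact (mem_flipIf_of_ne fun heq => hjk (ht _ _ heq)).trans (ih (by omega))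

/-- Uncomputation repeats the flips in reverse order; each one cancels the last remaining link. -/
theorem flipIf_flipChain_succ (b : ℕ → Bool) (t : ℕ → ℕ) (w : Finset ℕ) (k : ℕ) :
    flipIf (b (k + 1)) (t (k + 1)) (flipChain b t w (k + 1)) = flipChain b t w k := by
  rw [flipChain, flipIf_flipIf_self, Bool.xor_self, flipIf_false]

/-! ### Programs that answer queries

Variable `0` contains `q`, variable `1` the bit length of the elements of `X`, and a loop nested in
`m - 4` others uses variable `m`. Qubit `0` is a scratch bit; the next qubits compare the query with
the measured one, and the remaining ones contain the one-hot states of an automaton that computes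
the residue of the query. -/

namespace Prog

/-- The number of moduli of the hash function. -/
def moduli : Expr :=
  .mul (.const 2) (.add (.mul (.var 1) (.mul (.const 2) (.var 0))) (.const 4))

/-- Qubit `k + 1` becomes set if qubit `k` is set and bit `k` of the query is as measured. -/
def compareLayer (k : Expr) : Prog :=
  .seq (.readX k (.const 0)) <| .seq (.readOut k (.const 0)) <| .seq (.flip (.const 0)) <|
  .seq (.toffoli (.add (.const 1) k) (.const 0) (.add (.const 2) k)) <|
  .seq (.flip (.const 0)) <| .seq (.readOut k (.const 0)) (.readX k (.const 0))

/-- The qubit for state `s` of the automaton after `i` steps. -/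
def node (i s : Expr) : Expr :=
  .add (.add (.var 1) (.const 2)) (.add (.mul i moduli) s)

/-- One transition of the automaton, for the modulus in variable `5` plus one. -/
def automatonStep (i : Expr) : Prog :=
  .seq (.toffoli (node i (.var 7)) (node i (.var 7))
    (node (.add i (.const 1)) (.mod (.mul (.const 2) (.var 7)) (.add (.var 5) (.const 1))))) <|
  .seq (.toffoli (node i (.var 7)) (.const 0)
    (node (.add i (.const 1)) (.mod (.mul (.const 2) (.var 7)) (.add (.var 5) (.const 1)))))
  (.toffoli (node i (.var 7)) (.const 0)
    (node (.add i (.const 1))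
      (.mod (.add (.mul (.const 2) (.var 7)) (.const 1)) (.add (.var 5) (.const 1)))))

/-- All transitions of the automaton that read bit `i` of the query, from the left. -/
def automatonLayer (i : Expr) : Prog :=
  .seq (.readX (.sub (.sub (.var 1) (.const 1)) i) (.const 0)) <|
  .seq (.loop 7 moduli (automatonStep i))
    (.readX (.sub (.sub (.var 1) (.const 1)) i) (.const 0))

/-- Add the cell of the residue of the query modulo variable `5` plus one. -/
def residueQuery : Prog :=
  .seq (.loop 6 (.var 1) (automatonLayer (.var 6))) <|
  .seq (.loop 6 moduli
    (.addY (.add (.const 1) (.add (.mul (.var 5) moduli) (.var 6))) (node (.var 1) (.var 6))))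
    (.loop 6 (.var 1) (automatonLayer (.sub (.sub (.var 1) (.const 1)) (.var 6))))

/-- Answer a query by the hash function, reprogrammed at the measured point if `e ≠ 0`. -/
def answerQuery (e : Expr) : Prog :=
  .seq (.ite e (.readC (.const 1)) .skip) <|
  .seq (.loop 5 (.var 1) (compareLayer (.var 5))) <|
  .seq (.addY (.const 0) (.add (.const 1) (.var 1))) <|
  .seq (.readC (node (.const 0) (.const 0))) <|
  .seq (.toffoli (.add (.const 1) (.var 1)) (.add (.const 1) (.var 1))
    (node (.const 0) (.const 0))) <|
  .seq (.loop 5 moduli residueQuery) <|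
  .seq (.toffoli (.add (.const 1) (.var 1)) (.add (.const 1) (.var 1))
    (node (.const 0) (.const 0))) <|
  .seq (.readC (node (.const 0) (.const 0))) <|
  .seq (.loop 5 (.var 1) (compareLayer (.sub (.sub (.var 1) (.const 1)) (.var 5))))
    (.ite e (.readC (.const 1)) .skip)

end Prog

/-! ### Residue automata -/

/-- The address of the qubit for state `s` of the automaton after `i` steps. -/
def nodeAddr (n M i s : ℕ) : ℕ := n + 2 + (i * M + s)

theorem nodeAddr_injective {n M i j s t : ℕ} (hs : s < M) (ht : t < M)
    (h : nodeAddr n M i s = nodeAddr n M j t) : i = j ∧ s = t :=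
  position_injective hs ht (by unfold nodeAddr at h; omega)

/-- The state of the automaton for the modulus `a + 1` after `i` of `n` steps on input `e`. -/
def residueState (e n a i : ℕ) : ℕ := e / 2 ^ (n - i) % (a + 1)

theorem residueState_lt (e n a i : ℕ) : residueState e n a i < a + 1 :=
  Nat.mod_lt _ (Nat.succ_pos a)

theorem residueState_zero {e n : ℕ} (a : ℕ) (h : e < 2 ^ n) : residueState e n a 0 = 0 := by
  simp [residueState, Nat.div_eq_of_lt h]

theorem residueState_self (e n a : ℕ) : residueState e n a n = e % (a + 1) := by
  simp [residueState]

/-- Horner's scheme: reading the next bit from the left doubles the number read so far and adds the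
bit. -/
theorem residueState_succ (e n a i : ℕ) (h : i < n) : residueState e n a (i + 1) =
    (2 * residueState e n a i + (e.testBit (n - 1 - i)).toNat) % (a + 1) := by
  obtain ⟨d, rfl⟩ : ∃ d, n = i + 1 + d := ⟨n - i - 1, by omega⟩
  have h1 : i + 1 + d - (i + 1) = d := by omega
  have h2 : i + 1 + d - i = d + 1 := by omega
  have h3 : i + 1 + d - 1 - i = d := by omega
  have hbit : e / 2 ^ d = 2 * (e / 2 ^ (d + 1)) + (e.testBit d).toNat := by
    rw [Nat.toNat_testBit, pow_succ, ← Nat.div_div_eq_div_mul]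
    omega
  rw [residueState, residueState, h1, h2, h3, hbit, Nat.add_mod, Nat.mul_mod]
  conv_rhs => rw [Nat.add_mod, Nat.mul_mod, Nat.mod_mod]

/-! ### Correctness of the programs that answer queries -/

section QuerySpec

set_option linter.unusedSectionVars false

variable {X Y Z : Type*} [Fintype X] [DecidableEq X] [Fintype Y] [DecidableEq Y] [AddCommGroup Y]
  [Fintype Z] [DecidableEq Z] {q : ℕ} {enc : X ↪ Fin (2 ^ bits X)}
  {A : OracleAlgorithm X Y Z q} {σ : ℕ → ℕ} {F : Frame X Y} {W : Bool → X → Finset ℕ}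
  {ψ : Reg X Y Z → ℂ}

/-- Does bit `k` of `x` agree with that of the measured query? -/
def sameBit (enc : X ↪ Fin (2 ^ bits X)) (o : Option X) (x : X) (k : ℕ) : Bool :=
  !((enc x).val.testBit k ^^ o.any fun x => (enc x).val.testBit k)

/-- Does `x` agree with the measured query in the first `k` bits? -/
def samePrefix (enc : X ↪ Fin (2 ^ bits X)) (o : Option X) (b : Bool) (x : X) : ℕ → Bool
  | 0 => b
  | k + 1 => samePrefix enc o b x k && sameBit enc o x k

theorem samePrefix_iff (o : Option X) (b : Bool) (x : X) (k : ℕ) :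
    samePrefix enc o b x k = true ↔ b = true ∧ ∀ j < k, sameBit enc o x j = true := by
  induction k with
  | zero => simp [samePrefix]
  | succ k ih =>
    simp only [samePrefix, Bool.and_eq_true, ih, Nat.lt_succ_iff_lt_or_eq]
    constructor
    · rintro ⟨⟨h1, h2⟩, h3⟩
      exact ⟨h1, fun j hj => hj.elim (h2 j) fun h => h ▸ h3⟩
    · rintro ⟨h1, h2⟩
      exact ⟨⟨h1, fun j hj => h2 j (Or.inl hj)⟩, h2 k (Or.inr rfl)⟩

/-- Codes are below `2 ^ bits X`, so all further bits vanish and equality of the first `bits X` bits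
is equality of codes. -/
theorem samePrefix_bits (x₀ : X) (b : Bool) (x : X) :
    samePrefix enc (some x₀) b x (bits X) = true ↔ b = true ∧ x = x₀ := by
  rw [samePrefix_iff]
  refine and_congr_right fun _ => ⟨fun h => ?_, ?_⟩
  · refine enc.injective (Fin.ext (Nat.eq_of_testBit_eq fun j => ?_))
    by_cases hj : j < bits X
    · simpa [sameBit] using h j hj
    · have hlt : ∀ x, (enc x).val < 2 ^ j := fun x =>
        (enc x).isLt.trans_le (Nat.pow_le_pow_right two_pos (by omega))
      rw [Nat.testBit_lt_two_pow (hlt _), Nat.testBit_lt_two_pow (hlt _)]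
  · rintro rfl j _
    simp [sameBit]

/-- The scratch qubit receives the negated exclusive or of the two bits, controls the flip, and is
reset by the same gates in reverse. -/
theorem triple_compareLayer {m : ℕ} {k : Expr} (hk : k.VarsLT m) (hW : ∀ c x, 0 ∉ W c x) :
    Triple enc A m σ F W ψ (.compareLayer k) F
      (fun c x => flipIf (decide (1 + k.eval σ ∈ W c x) && sameBit enc F.out x (k.eval σ))
        (2 + k.eval σ) (W c x)) ψ := by
  have h0 : (Expr.const 0).VarsLT m := trivial
  refine ((Triple.readX hk h0).seq <| (Triple.readOut hk h0).seq <| (Triple.flip h0).seq <|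
    (Triple.toffoli (a := .add (.const 1) k) ⟨trivial, hk⟩ h0 (t := .add (.const 2) k)
      ⟨trivial, hk⟩ ?_ ?_).seq <|
    (Triple.flip h0).seq <| (Triple.readOut hk h0).seq (Triple.readX hk h0)).congr_right ?_ rfl
  · simp only [Expr.eval]
    omega
  · simp only [Expr.eval]
    omega
  · intro c x
    simp only [Expr.eval, flipIf_flipIf_self]
    have h1 : ∀ b w, 1 + k.eval σ ∈ flipIf b 0 w ↔ 1 + k.eval σ ∈ w := fun b w =>
      mem_flipIf_of_ne (by omega)
    simp only [h1, mem_flipIf_self (hW c x)]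
    simp only [flipIf_comm _ _ 0 (2 + k.eval σ), flipIf_flipIf_self]
    unfold sameBit
    generalize (enc x).val.testBit (k.eval σ) = b
    generalize (F.out.any fun x => (enc x).val.testBit (k.eval σ)) = b'
    cases b <;> cases b' <;> simp [flipIf_false]

theorem Prog.moduli_eval {τ : ℕ → ℕ} {n q : ℕ} (h : τ 0 = q) (h' : τ 1 = n) :
    Prog.moduli.eval τ = numModuli n (2 * q) := by
  simp [Prog.moduli, Expr.eval, h, h', numModuli]

theorem Prog.moduli_varsLT {m : ℕ} (h : 1 < m) : Prog.moduli.VarsLT m := by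
  simp [Prog.moduli, Expr.VarsLT, h, (zero_lt_one.trans h)]

theorem Prog.node_varsLT {m : ℕ} (h : 1 < m) {i s : Expr} (hi : i.VarsLT m) (hs : s.VarsLT m) :
    (Prog.node i s).VarsLT m :=
  ⟨⟨h, trivial⟩, ⟨hi, Prog.moduli_varsLT h⟩, hs⟩

theorem Prog.node_eval {τ : ℕ → ℕ} {n q : ℕ} (h : τ 0 = q) (h' : τ 1 = n) (i s : Expr) :
    (Prog.node i s).eval τ = nodeAddr n (numModuli n (2 * q)) (i.eval τ) (s.eval τ) := by
  simp [Prog.node, Expr.eval, Prog.moduli_eval h h', h', nodeAddr]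

theorem zero_ne_nodeAddr (n M i s : ℕ) : 0 ≠ nodeAddr n M i s := by
  unfold nodeAddr
  omega

theorem nodeAddr_ne_succ {n M i s a k : ℕ} (hk : k < M) (ha : a < M) :
    nodeAddr n M i k ≠ nodeAddr n M (i + 1) (s % (a + 1)) := fun heq => by
  have h : s % (a + 1) < a + 1 := Nat.mod_lt _ (Nat.succ_pos a)
  have := (nodeAddr_injective hk (by omega) heq).1
  omega

/-- The first gate flips the successor for bit 0 unconditionally. If the bit is 1, the second gate
undoes this and the third flips the other successor. This stays correct if both successors coincide.
-/
theorem triple_automatonStep {i : Expr} {n M a k iv : ℕ} {act bit : Bool → X → Bool}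
    {st : X → ℕ} (hM : M = numModuli n (2 * q)) (hq : σ 0 = q) (hn : σ 1 = n) (ha : σ 5 = a)
    (hk : σ 7 = k) (hi : i.VarsLT 8) (hiv : i.eval σ = iv) (hkM : k < M) (haM : a < M)
    (hbit : ∀ c x, 0 ∈ W c x ↔ bit c x = true)
    (hnode : ∀ c x, nodeAddr n M iv k ∈ W c x ↔ (act c x = true ∧ k = st x)) :
    Triple enc A 8 σ F W ψ (.automatonStep i) F
      (fun c x => flipIf (act c x && decide (k = st x))
        (nodeAddr n M (iv + 1) ((2 * st x + (bit c x).toNat) % (a + 1))) (W c x)) ψ := by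
  have hsrc := Prog.node_varsLT (m := 8) (by norm_num) hi (s := .var 7) (by simp [Expr.VarsLT])
  have ht0 := Prog.node_varsLT (m := 8) (by norm_num) (i := .add i (.const 1)) ⟨hi, trivial⟩
    (s := .mod (.mul (.const 2) (.var 7)) (.add (.var 5) (.const 1))) (by simp [Expr.VarsLT])
  have ht1 := Prog.node_varsLT (m := 8) (by norm_num) (i := .add i (.const 1)) ⟨hi, trivial⟩
    (s := .mod (.add (.mul (.const 2) (.var 7)) (.const 1)) (.add (.var 5) (.const 1)))
    (by simp [Expr.VarsLT])
  have h0 : (Expr.const 0).VarsLT 8 := trivial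
  have hes : (Prog.node i (.var 7)).eval σ = nodeAddr n M iv k := by
    rw [Prog.node_eval hq hn, ← hM, hiv, Expr.eval, hk]
  have he0 : (Prog.node (.add i (.const 1))
      (.mod (.mul (.const 2) (.var 7)) (.add (.var 5) (.const 1)))).eval σ =
      nodeAddr n M (iv + 1) (2 * k % (a + 1)) := by
    rw [Prog.node_eval hq hn, ← hM]
    simp only [Expr.eval, hiv, hk, ha]
  have he1 : (Prog.node (.add i (.const 1))
      (.mod (.add (.mul (.const 2) (.var 7)) (.const 1)) (.add (.var 5) (.const 1)))).eval σ =
      nodeAddr n M (iv + 1) ((2 * k + 1) % (a + 1)) := by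
    rw [Prog.node_eval hq hn, ← hM]
    simp only [Expr.eval, hiv, hk, ha]
  have hez : (Expr.const 0).eval σ = 0 := rfl
  have hne := fun s => nodeAddr_ne_succ (n := n) (i := iv) (s := s) hkM haM
  have hpos := zero_ne_nodeAddr n M (iv + 1)
  refine ((Triple.toffoli hsrc hsrc ht0 ?_ ?_).seq <| (Triple.toffoli hsrc h0 ht0 ?_ ?_).seq
    (Triple.toffoli hsrc h0 ht1 ?_ ?_)).congr_right ?_ rfl
  · rw [hes, he0]
    exact hne _
  · rw [hes, he0]
    exact hne _
  · rw [hes, he0]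
    exact hne _
  · rw [hez, he0]
    exact hpos _
  · rw [hes, he1]
    exact hne _
  · rw [hez, he1]
    exact hpos _
  intro c x
  rw [hes, he0, he1, hez]
  have hm1 : ∀ b s w, nodeAddr n M iv k ∈ flipIf b (nodeAddr n M (iv + 1) (s % (a + 1))) w ↔
      nodeAddr n M iv k ∈ w := fun b s w => mem_flipIf_of_ne (hne s)
  have hm2 : ∀ b s w, 0 ∈ flipIf b (nodeAddr n M (iv + 1) (s % (a + 1))) w ↔ 0 ∈ w :=
    fun b s w => mem_flipIf_of_ne (hpos _)
  simp only [hm1, hm2, hnode, hbit]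
  by_cases h : act c x = true ∧ k = st x
  · obtain ⟨hact, hks⟩ := h
    rw [hact, ← hks]
    cases bit c x <;> simp [flipIf_flipIf_self, flipIf_false]
  · have h' : (act c x && decide (k = st x)) = false := by
      simpa using h
    simp [h, h', flipIf_false]

theorem triple_automatonLayer {i : Expr} {n M a iv : ℕ} {act : Bool → X → Bool} {st : X → ℕ}
    (hM : M = numModuli n (2 * q)) (hq : σ 0 = q) (hn : σ 1 = n) (ha : σ 5 = a)
    (hi : i.VarsLT 7) (hiv : i.eval σ = iv)
    (hst : ∀ x, st x < M) (hW : ∀ c x, 0 ∉ W c x)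
    (hnode : ∀ c x, ∀ s < M, nodeAddr n M iv s ∈ W c x ↔ (act c x = true ∧ s = st x))
    (haM : a < M) :
    Triple enc A 7 σ F W ψ (.automatonLayer i) F
      (fun c x => flipIf (act c x) (nodeAddr n M (iv + 1)
        ((2 * st x + ((enc x).val.testBit (n - 1 - iv)).toNat) % (a + 1))) (W c x)) ψ := by
  have h0 : (Expr.const 0).VarsLT 7 := trivial
  have hidx : (Expr.sub (.sub (.var 1) (.const 1)) i).VarsLT 7 :=
    ⟨⟨by simp [Expr.VarsLT], trivial⟩, hi⟩
  have hidxe : (Expr.sub (.sub (.var 1) (.const 1)) i).eval σ = n - 1 - iv := by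
    simp only [Expr.eval, hn, hiv]
  have hMe : Prog.moduli.eval σ = M := (Prog.moduli_eval hq hn).trans hM.symm
  set bit : X → Bool := fun x => (enc x).val.testBit (n - 1 - iv) with hbit
  set tgt : X → ℕ := fun x => nodeAddr n M (iv + 1) ((2 * st x + (bit x).toNat) % (a + 1))
    with htgt
  have htgt0 : ∀ x, 0 ≠ tgt x := fun x => zero_ne_nodeAddr _ _ _ _
  -- Loop invariant: the input bit is in the scratch qubit, and the successor of the current state
  -- has been flipped once the counter has passed that state.
  let Wk : ℕ → Bool → X → Finset ℕ := fun k c x =>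
    flipIf (act c x && decide (st x < k)) (tgt x) (flipIf (bit x) 0 (W c x))
  have hloop : Triple enc A 7 σ F (Wk 0) ψ (.loop 7 Prog.moduli (Prog.automatonStep i)) F
      (Wk (Prog.moduli.eval σ)) ψ := by
    refine Triple.loop (Prog.moduli_varsLT (by norm_num)) (fun _ => F) Wk (fun _ => ψ)
      fun k hk => ?_
    rw [hMe] at hk
    refine (triple_automatonStep (n := n) (M := M) (a := a) (k := k) (iv := iv) (act := act)
      (bit := fun _ => bit) (st := st) hM ?_ ?_ ?_ ?_ (hi.mono (by norm_num)) ?_ hk haM ?_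
      ?_).congr_right ?_ rfl
    · simp [hq]
    · simp [hn]
    · simp [ha]
    · simp
    · rw [← hiv]
      exact Expr.eval_congr (fun j hj => Function.update_of_ne (by omega) _ _) hi
    · intro c x
      exact (mem_flipIf_of_ne (htgt0 x)).trans (mem_flipIf_self (hW c x))
    · intro c x
      refine (mem_flipIf_of_ne (nodeAddr_ne_succ hk haM)).trans
        ((mem_flipIf_of_ne (zero_ne_nodeAddr _ _ _ _).symm).trans (hnode c x k hk))
    · intro c x
      change flipIf _ (tgt x) (flipIf _ (tgt x) _) = flipIf _ (tgt x) _
      rw [flipIf_flipIf_self]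
      congr 1
      by_cases hact : act c x = true
      · by_cases hks : k = st x
        · simp [hact, hks]
        · have : st x < k + 1 ↔ st x < k := by omega
          simp [hact, hks, this]
      · simp [hact]
  have hpre : Triple enc A 7 σ F W ψ (.readX (.sub (.sub (.var 1) (.const 1)) i) (.const 0)) F
      (Wk 0) ψ := (Triple.readX hidx h0).congr_right (fun c x => by
        rw [hidxe]
        simp [Wk, hbit, Expr.eval, flipIf_false]) rfl
  refine (hpre.seq (hloop.seq (Triple.readX hidx h0))).congr_right (fun c x => ?_) rfl
  rw [hMe, hidxe]
  change flipIf (bit x) 0 (flipIf _ (tgt x) (flipIf (bit x) 0 (W c x))) = flipIf _ (tgt x) _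
  rw [flipIf_comm, flipIf_flipIf_self]
  simp [hst x, flipIf_false]

/-- The qubits after `k` steps of the automaton for the modulus `a + 1` on input `e`. -/
def residueChain (n M a e : ℕ) (b : Bool) (w : Finset ℕ) (k : ℕ) : Finset ℕ :=
  flipChain (fun _ => b) (fun j => nodeAddr n M j (residueState e n a j)) w k

theorem mem_residueChain_iff {n M a e i s k : ℕ} {b : Bool} {w : Finset ℕ}
    (hw : ∀ u ∈ w, u < n + 2) (ha : a < M) (hs : s < M) (hi : i ≤ k) :
    nodeAddr n M i s ∈ residueChain n M a e b w k ↔ (b = true ∧ s = residueState e n a i) := by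
  have hst : ∀ j, residueState e n a j < M := fun j =>
    (residueState_lt e n a j).trans_le ha
  have hnot : ∀ j s, nodeAddr n M j s ∉ w := fun j s h => by
    have := hw _ h
    unfold nodeAddr at this
    omega
  by_cases hsi : s = residueState e n a i
  · subst hsi
    simp only [and_true]
    exact mem_flipChain_self (b := fun _ => b)
      (t := fun j => nodeAddr n M j (residueState e n a j))
      (fun j j' h => (nodeAddr_injective (hst j) (hst j') h).1) (fun j => hnot _ _) hi
  · simp only [hsi, and_false, iff_false]
    intro h
    refine hnot i s ((mem_flipChain_of_ne fun j _ heq => ?_).1 h)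
    obtain ⟨rfl, h2⟩ := nodeAddr_injective hs (hst j) heq
    exact hsi h2

theorem zero_notMem_residueChain {n M a e k : ℕ} {b : Bool} {w : Finset ℕ} (hw : 0 ∉ w) :
    0 ∉ residueChain n M a e b w k := fun h =>
  hw ((mem_flipChain_of_ne fun _ _ => zero_ne_nodeAddr _ _ _ _).1 h)

theorem triple_residueQuery {n M a : ℕ} {act : Bool → X → Bool}
    (hM : M = numModuli n (2 * q)) (hq : σ 0 = q) (hn : σ 1 = n) (ha : σ 5 = a) (haM : a < M)
    (henc : ∀ x, (enc x).val < 2 ^ n) (hW : ∀ c x, ∀ u ∈ W c x, u < n + 2)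
    (hW0 : ∀ c x, 0 ∉ W c x) :
    Triple enc A 6 σ F (fun c x => flipIf (act c x) (nodeAddr n M 0 0) (W c x)) ψ .residueQuery
      F (fun c x => flipIf (act c x) (nodeAddr n M 0 0) (W c x))
      (shiftY (fun c x => if act c x then F.cells (1 + (a * M + (enc x).val % (a + 1))) else 0)
        ψ) := by
  let Wk : ℕ → Bool → X → Finset ℕ := fun k c x =>
    residueChain n M a (enc x) (act c x) (W c x) k
  have hWk0 : (fun c x => flipIf (act c x) (nodeAddr n M 0 0) (W c x)) = Wk 0 := by
    funext c x
    simp [Wk, residueChain, flipChain, residueState_zero a (henc x)]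
  have hst : ∀ (x : X) (j : ℕ), residueState (enc x) n a j < M := fun x j =>
    (residueState_lt (enc x) n a j).trans_le haM
  -- Allowing k ≥ `iv` covers both directions: k = `iv` when layer `iv + 1` is computed, k = `iv +
  -- 1` when it is erased.
  have hlayer : ∀ (τ : ℕ → ℕ) (i : Expr) (iv k : ℕ), τ 0 = q → τ 1 = n → τ 5 = a →
      i.VarsLT 7 → i.eval τ = iv → iv ≤ k → iv < n → ∀ χ : Reg X Y Z → ℂ,
      Triple enc A 7 τ F (Wk k) χ (.automatonLayer i) F
        (fun c x => flipIf (act c x) (nodeAddr n M (iv + 1) (residueState (enc x) n a (iv + 1)))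
          (Wk k c x)) χ := by
    intro τ i iv k h0 h1 h5 hi hiv hik hin χ
    refine (triple_automatonLayer (act := act) (st := fun x => residueState (enc x) n a iv)
      hM h0 h1 h5 hi hiv (fun x => hst x _) (fun c x => zero_notMem_residueChain (hW0 c x))
      (fun c x s hs => mem_residueChain_iff (hW c x) haM hs hik) haM).congr_right ?_ rfl
    intro c x
    rw [residueState_succ _ _ _ _ hin]
  have hvar1 : (Expr.var 1).VarsLT 6 := by simp [Expr.VarsLT]
  have hfwd : Triple enc A 6 σ F (Wk 0) ψ (.loop 6 (.var 1) (.automatonLayer (.var 6))) F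
      (Wk n) ψ := by
    have := Triple.loop (enc := enc) (A := A) (σ := σ) (p := .automatonLayer (.var 6))
      hvar1 (fun _ => F) Wk (fun _ => ψ) fun k hk =>
        hlayer (Function.update σ 6 k) (.var 6) k k (by simp [hq]) (by simp [hn]) (by simp [ha])
          (by simp [Expr.VarsLT]) (by simp [Expr.eval]) le_rfl (by simpa [Expr.eval, hn] using hk) _
    simpa [Expr.eval, hn] using this
  have hbwd : ∀ χ : Reg X Y Z → ℂ, Triple enc A 6 σ F (Wk n) χ
      (.loop 6 (.var 1) (.automatonLayer (.sub (.sub (.var 1) (.const 1)) (.var 6)))) F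
      (Wk 0) χ := by
    intro χ
    have := Triple.loop (enc := enc) (A := A) (σ := σ)
      (p := .automatonLayer (.sub (.sub (.var 1) (.const 1)) (.var 6)))
      hvar1 (fun _ => F) (fun k => Wk (n - k)) (fun _ => χ) fun k hk => by
        have hk' : k < n := by simpa [Expr.eval, hn] using hk
        obtain ⟨d, hd⟩ : ∃ d, n - k = d + 1 := ⟨n - k - 1, by omega⟩
        have hd' : n - (k + 1) = d := by omega
        refine (hlayer (Function.update σ 6 k) _ d (n - k) (by simp [hq]) (by simp [hn])
          (by simp [ha]) (by simp [Expr.VarsLT]) ?_ (by omega) (by omega) _).congr_right ?_ rfl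
        · simp only [Expr.eval, Function.update_self]
          rw [Function.update_of_ne (by norm_num), hn]
          omega
        · intro c x
          simp only [hd, hd']
          exact flipIf_flipChain_succ (fun _ => act c x)
            (fun j => nodeAddr n M j (residueState (enc x) n a j)) (W c x) d
    simpa [Expr.eval, hn] using this
  have hMe : Prog.moduli.eval σ = M := (Prog.moduli_eval hq hn).trans hM.symm
  have hadd : Triple enc A 6 σ F (Wk n) ψ (.loop 6 Prog.moduli
      (.addY (.add (.const 1) (.add (.mul (.var 5) Prog.moduli) (.var 6)))
        (Prog.node (.var 1) (.var 6))))
      F (Wk n)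
      (shiftY (fun c x => if act c x then F.cells (1 + (a * M + (enc x).val % (a + 1))) else 0)
        ψ) := by
    have h6 : (1 : ℕ) < 6 := by norm_num
    -- Invariant: the selected cell has been added as soon as the counter exceeds the residue. In
    -- the last layer only the qubit of the residue can be set.
    have := Triple.loop (enc := enc) (A := A) (σ := σ) (p :=
      (.addY (.add (.const 1) (.add (.mul (.var 5) Prog.moduli) (.var 6)))
        (Prog.node (.var 1) (.var 6))))
      (Prog.moduli_varsLT h6) (fun _ => F) (fun _ => Wk n)
      (fun k => shiftY (fun c x => if act c x = true ∧ (enc x).val % (a + 1) < k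
        then F.cells (1 + (a * M + (enc x).val % (a + 1))) else 0) ψ) fun k hk => by
        rw [hMe] at hk
        have hcell : (Expr.add (.const 1) (.add (.mul (.var 5) Prog.moduli) (.var 6))).VarsLT 7 :=
          ⟨trivial, ⟨by simp [Expr.VarsLT], Prog.moduli_varsLT (by norm_num)⟩,
            by simp [Expr.VarsLT]⟩
        have hqubit : (Prog.node (.var 1) (.var 6)).VarsLT 7 :=
          Prog.node_varsLT (by norm_num) (by simp [Expr.VarsLT]) (by simp [Expr.VarsLT])
        refine (Triple.addY hcell hqubit).congr_right (fun _ _ => rfl) ?_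
        rw [shiftY_shiftY]
        congr 1
        funext c x
        rw [Prog.node_eval (q := q) (n := n) (by simp [hq]) (by simp [hn]), ← hM]
        simp only [Expr.eval]
        rw [Prog.moduli_eval (q := q) (n := n) (by simp [hq]) (by simp [hn]), ← hM]
        simp only [Function.update_self]
        rw [Function.update_of_ne (by norm_num), Function.update_of_ne (by norm_num), hn, ha]
        have hmem : nodeAddr n M n k ∈ Wk n c x ↔ (act c x = true ∧ k = (enc x).val % (a + 1)) := by
          rw [mem_residueChain_iff (hW c x) haM hk le_rfl, residueState_self]
        simp only [hmem]
        by_cases hact : act c x = true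
        · by_cases hks : k = (enc x).val % (a + 1)
          · simp [hact, ← hks]
          · have : (enc x).val % (a + 1) < k + 1 ↔ (enc x).val % (a + 1) < k := by omega
            simp [hact, hks, this]
        · simp [hact]
    rw [hMe] at this
    have hlt : ∀ x : X, (enc x).val % (a + 1) < M := fun x =>
      (Nat.mod_lt _ (Nat.succ_pos a)).trans_le haM
    simpa [hlt, shiftY_zero] using this
  rw [hWk0]
  exact hfwd.seq (hadd.seq (hbwd _))

/-- The comparison decides which of two additions happens: cell 0, containing `θ`, at the
reprogrammed point, and the hash value elsewhere. Everything before the additions depends on c and x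
only and is undone afterwards. -/
theorem triple_answerQuery {e : Expr} (hq : σ 0 = q) (hn : σ 1 = bits X) (he : e.VarsLT 5)
    {H : X → Y} (hH : ∀ x₀, F.out = some x₀ →
      H = if e.eval σ ≠ 0 then
        Function.update (residueHash (fun x => (enc x).val) (numModuli (bits X) (2 * q)) F.cells)
          x₀ (F.cells 0)
        else residueHash (fun x => (enc x).val) (numModuli (bits X) (2 * q)) F.cells)
    (hH' : F.out = none →
      e.eval σ = 0 ∧
        H = residueHash (fun x => (enc x).val) (numModuli (bits X) (2 * q)) F.cells) :
    Triple enc A 5 σ F (fun _ _ => ∅) ψ (.answerQuery e) F (fun _ _ => ∅) (query H ψ) := by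
  obtain ⟨n, hbn⟩ : ∃ n, n = bits X := ⟨_, rfl⟩
  obtain ⟨M, hM'⟩ : ∃ M, M = numModuli (bits X) (2 * q) := ⟨_, rfl⟩
  rw [← hM'] at hH hH'
  have hM : M = numModuli n (2 * q) := by rw [hM', hbn]
  have henc : ∀ x, (enc x).val < 2 ^ n := fun x => (enc x).isLt.trans_eq (by rw [hbn])
  have hsame : ∀ x₀, F.out = some x₀ → ∀ b x,
      samePrefix enc F.out b x n = true ↔ b = true ∧ x = x₀ := fun x₀ ho b x => by
    rw [ho, hbn]
    exact samePrefix_bits x₀ b x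
  have hsame' : ∀ x, samePrefix enc F.out false x n = false := fun x => by
    simpa using (samePrefix_iff (enc := enc) F.out false x n).not
  replace hn : σ 1 = n := hn.trans hbn.symm
  clear hbn hM'
  -- The comparison chain starts from this bit, so without reprogramming, or with the control off,
  -- it never reports equality.
  let md : Bool → Bool := fun c => decide (e.eval σ ≠ 0) && c
  let Wk : ℕ → Bool → X → Finset ℕ := fun k c x =>
    flipChain (samePrefix enc F.out (md c) x) (fun j => 1 + j) ∅ k
  have hWk_lt : ∀ k ≤ n, ∀ c x, ∀ u ∈ Wk k c x, u < n + 2 := by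
    intro k hk c x u hu
    by_contra hlt
    exact Finset.notMem_empty u ((mem_flipChain_of_ne fun j hj heq => by omega).1 hu)
  have hWk_zero : ∀ k c x, 0 ∉ Wk k c x := fun k c x h =>
    Finset.notMem_empty 0 ((mem_flipChain_of_ne fun j hj heq => by omega).1 h)
  have hWk_mem : ∀ j k c x, j ≤ k →
      (1 + j ∈ Wk k c x ↔ samePrefix enc F.out (md c) x j = true) := fun j k c x hjk =>
    mem_flipChain_self (t := fun j => 1 + j) (fun i j h => by omega)
      (fun j => Finset.notMem_empty _) hjk
  have hvar1 : (Expr.var 1).VarsLT 5 := by simp [Expr.VarsLT]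
  have h05 : (Expr.const 0).VarsLT 5 := trivial
  have h15 : (Expr.const 1).VarsLT 5 := trivial
  have hmode : ∀ (w : Bool → X → Finset ℕ) (χ : Reg X Y Z → ℂ),
      Triple enc A 5 σ F w χ (.ite e (.readC (.const 1)) .skip) F
        (fun c x => flipIf (md c) 1 (w c x)) χ := by
    intro w χ
    refine Triple.ite he (fun h => (Triple.readC h15).congr_right (fun c x => ?_) rfl)
      (fun h => Triple.skip.congr_right (fun c x => ?_) rfl)
    · simp [md, h, Expr.eval]
    · simp [md, h, flipIf_false]
  have hstart : Triple enc A 5 σ F (fun _ _ => ∅) ψ (.ite e (.readC (.const 1)) .skip) F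
      (Wk 0) ψ := hmode _ _
  have hfinish : ∀ χ : Reg X Y Z → ℂ,
      Triple enc A 5 σ F (Wk 0) χ (.ite e (.readC (.const 1)) .skip) F (fun _ _ => ∅) χ :=
    fun χ => (hmode _ _).congr_right (fun c x => by
      change flipIf (md c) 1 (flipIf (md c) (1 + 0) ∅) = ∅
      rw [add_zero, flipIf_flipIf_self, Bool.xor_self, flipIf_false]) rfl
  have hcomp : ∀ (τ : ℕ → ℕ) (k : Expr) (kv j : ℕ), k.VarsLT 6 → k.eval τ = kv → kv ≤ j →
      ∀ χ : Reg X Y Z → ℂ, Triple enc A 6 τ F (Wk j) χ (.compareLayer k) F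
        (fun c x => flipIf (samePrefix enc F.out (md c) x (kv + 1)) (1 + (kv + 1)) (Wk j c x))
        χ := by
    intro τ k kv j hk hkv hkj χ
    refine (triple_compareLayer hk (hWk_zero j)).congr_right (fun c x => ?_) rfl
    rw [hkv]
    simp only [hWk_mem kv j c x hkj, Bool.decide_eq_true]
    rw [show 2 + kv = 1 + (kv + 1) by omega]
    rfl
  have hfwd : ∀ χ : Reg X Y Z → ℂ, Triple enc A 5 σ F (Wk 0) χ
      (.loop 5 (.var 1) (.compareLayer (.var 5))) F (Wk n) χ := by
    intro χ
    have := Triple.loop (enc := enc) (A := A) (σ := σ) (p := .compareLayer (.var 5))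
      hvar1 (fun _ => F) Wk (fun _ => χ) fun k hk =>
        hcomp (Function.update σ 5 k) (.var 5) k k (by simp [Expr.VarsLT]) (by simp [Expr.eval])
          le_rfl _
    simpa [Expr.eval, hn] using this
  have hbwd : ∀ χ : Reg X Y Z → ℂ, Triple enc A 5 σ F (Wk n) χ
      (.loop 5 (.var 1) (.compareLayer (.sub (.sub (.var 1) (.const 1)) (.var 5)))) F
      (Wk 0) χ := by
    intro χ
    have := Triple.loop (enc := enc) (A := A) (σ := σ)
      (p := .compareLayer (.sub (.sub (.var 1) (.const 1)) (.var 5)))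
      hvar1 (fun _ => F) (fun k => Wk (n - k)) (fun _ => χ) fun k hk => by
        have hk' : k < n := by simpa [Expr.eval, hn] using hk
        obtain ⟨d, hd⟩ : ∃ d, n - k = d + 1 := ⟨n - k - 1, by omega⟩
        have hd' : n - (k + 1) = d := by omega
        refine (hcomp (Function.update σ 5 k) _ d (n - k) (by simp [Expr.VarsLT]) ?_ (by omega)
          _).congr_right ?_ rfl
        · simp only [Expr.eval, Function.update_self]
          rw [Function.update_of_ne (by norm_num), hn]
          omega
        · intro c x
          simp only [hd, hd']
          exact flipIf_flipChain_succ (samePrefix enc F.out (md c) x) (fun j => 1 + j) ∅ d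
    simpa [Expr.eval, hn] using this
  let eq : Bool → X → Bool := fun c x => samePrefix enc F.out (md c) x n
  have hlast : (Expr.add (.const 1) (.var 1)).VarsLT 5 := ⟨trivial, hvar1⟩
  have hlaste : (Expr.add (.const 1) (.var 1)).eval σ = 1 + n := by simp [Expr.eval, hn]
  have hzero : (Prog.node (.const 0) (.const 0)).VarsLT 5 :=
    Prog.node_varsLT (by norm_num) trivial trivial
  have hzeroe : (Prog.node (.const 0) (.const 0)).eval σ = nodeAddr n M 0 0 := by
    rw [Prog.node_eval hq hn, ← hM]
    rfl
  have hne : 1 + n ≠ nodeAddr n M 0 0 := by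
    unfold nodeAddr
    omega
  have hreprog : Triple enc A 5 σ F (Wk n) ψ
      (.addY (.const 0) (.add (.const 1) (.var 1))) F (Wk n)
      (shiftY (fun c x => if eq c x then F.cells 0 else 0) ψ) := by
    refine (Triple.addY h05 hlast).congr_right (fun _ _ => rfl) ?_
    simp only [hlaste, hWk_mem n n _ _ le_rfl]
    rfl
  -- As `eq` implies c, this is "control set and point not reprogrammed".
  let act : Bool → X → Bool := fun c x => c ^^ eq c x
  let W' : Bool → X → Finset ℕ := fun c x => flipIf (act c x) (nodeAddr n M 0 0) (Wk n c x)
  have hread : ∀ χ : Reg X Y Z → ℂ, ∀ w, Triple enc A 5 σ F w χ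
      (.readC (Prog.node (.const 0) (.const 0))) F
      (fun c x => flipIf c (nodeAddr n M 0 0) (w c x)) χ := fun χ w =>
    (Triple.readC hzero).congr_right (fun c x => by rw [hzeroe]) rfl
  have htof : ∀ χ : Reg X Y Z → ℂ, ∀ b : Bool → X → Bool, Triple enc A 5 σ F
      (fun c x => flipIf (b c x) (nodeAddr n M 0 0) (Wk n c x)) χ
      (.toffoli (.add (.const 1) (.var 1)) (.add (.const 1) (.var 1))
        (Prog.node (.const 0) (.const 0))) F
      (fun c x => flipIf (eq c x ^^ b c x) (nodeAddr n M 0 0) (Wk n c x)) χ := by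
    intro χ b
    refine (Triple.toffoli hlast hlast hzero ?_ ?_).congr_right (fun c x => ?_) rfl
    · rw [hlaste, hzeroe]
      exact hne
    · rw [hlaste, hzeroe]
      exact hne
    · rw [hlaste, hzeroe]
      simp only [mem_flipIf_of_ne hne, hWk_mem n n c x le_rfl, Bool.decide_eq_true, Bool.and_self]
      rw [flipIf_flipIf_self]
  have hon : ∀ χ : Reg X Y Z → ℂ, Triple enc A 5 σ F (fun c x => flipIf c (nodeAddr n M 0 0)
      (Wk n c x)) χ (.toffoli (.add (.const 1) (.var 1)) (.add (.const 1) (.var 1))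
        (Prog.node (.const 0) (.const 0))) F W' χ := fun χ =>
    (htof χ fun c _ => c).congr_right (fun c x => by simp only [W', act, Bool.xor_comm]) rfl
  have hoff : ∀ χ : Reg X Y Z → ℂ, Triple enc A 5 σ F W' χ
      (.toffoli (.add (.const 1) (.var 1)) (.add (.const 1) (.var 1))
        (Prog.node (.const 0) (.const 0))) F (fun c x => flipIf c (nodeAddr n M 0 0)
      (Wk n c x)) χ := fun χ =>
    (htof χ act).congr_right (fun c x => by
      have : (eq c x ^^ act c x) = c := by
        simp only [act]
        cases eq c x <;> cases c <;> rfl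
      rw [this]) rfl
  have hunread : ∀ χ : Reg X Y Z → ℂ, Triple enc A 5 σ F (fun c x => flipIf c (nodeAddr n M 0 0)
      (Wk n c x)) χ (.readC (Prog.node (.const 0) (.const 0))) F (Wk n) χ := fun χ =>
    (hread χ _).congr_right (fun c x => by
      rw [flipIf_flipIf_self, Bool.xor_self, flipIf_false]) rfl
  have hMe : Prog.moduli.eval σ = M := (Prog.moduli_eval hq hn).trans hM.symm
  let hash : ℕ → X → Y := fun k x =>
    ∑ a ∈ range k, F.cells (1 + (a * M + (enc x).val % (a + 1)))
  have hhash : ∀ χ : Reg X Y Z → ℂ, Triple enc A 5 σ F W' χ (.loop 5 Prog.moduli .residueQuery) F W'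
      (shiftY (fun c x => if act c x then hash M x else 0) χ) := by
    intro χ
    have := Triple.loop (enc := enc) (A := A) (σ := σ) (p := .residueQuery)
      (Prog.moduli_varsLT (m := 5) (by norm_num)) (fun _ => F) (fun _ => W')
      (fun k => shiftY (fun c x => if act c x then hash k x else 0) χ) fun k hk => by
        rw [hMe] at hk
        refine (triple_residueQuery (act := act) hM (by simp [hq]) (by simp [hn]) (by simp) hk
          henc (hWk_lt n le_rfl) (hWk_zero n)).congr_right (fun _ _ => rfl) ?_
        rw [shiftY_shiftY]
        congr 1
        funext c x
        by_cases hact : act c x = true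
        · simp [hact, hash, Finset.sum_range_succ, add_comm]
        · simp [hact]
    rw [hMe] at this
    simpa [hash, shiftY_zero] using this
  refine (hstart.seq <| (hfwd _).seq <| hreprog.seq <| (hread _ _).seq <| (hon _).seq <|
    (hhash _).seq <| (hoff _).seq <| (hunread _).seq <| (hbwd _).seq (hfinish _)).congr_right
    (fun _ _ => rfl) ?_
  rw [shiftY_shiftY, query_eq_shiftY]
  congr 1
  funext c x
  have hhM : hash M x = residueHash (fun x => (enc x).val) M F.cells x := rfl
  rw [hhM]
  cases ho : F.out with
  | none =>
    obtain ⟨he0, rfl⟩ := hH' ho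
    have : eq c x = false := by
      simp only [eq, md, he0]
      exact hsame' x
    cases c <;> simp [act, this]
  | some x₀ =>
    obtain rfl := hH x₀ ho
    have heq : eq c x = true ↔ md c = true ∧ x = x₀ := hsame x₀ ho _ _
    by_cases he0 : e.eval σ = 0
    · have : eq c x = false := by
        rw [← Bool.not_eq_true, heq]
        simp [md, he0]
      cases c <;> simp [act, this, he0]
    · cases c
      · have : eq false x = false := by
          rw [← Bool.not_eq_true, heq]
          simp [md]
        simp [act, this]
      · by_cases hx : x = x₀
        · subst hx
          have : eq true x = true := by
            rw [heq]
            simp [md, he0]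
          simp [act, this, he0]
        · have : eq true x = false := by
            rw [← Bool.not_eq_true, heq]
            simp [hx]
          simp [act, this, he0, hx]

end QuerySpec

/-! ### The simulator -/

namespace Prog

/-- Fill the cells of the hash function. -/
def fillCells : Prog :=
  .loop 3 (.mul moduli moduli) (.randY (.add (.const 1) (.var 3)))

/-- Run `A` up to a random query, which is measured. The random number in variable `3` determines
this query, and whether it will be answered by the reprogrammed function. -/
def firstStage : Prog :=
  .seq fillCells <| .seq (.rand 3 (.mul (.const 2) (.var 0))) <|
  .seq (.loop 4 (.div (.var 3) (.const 2)) (.seq (answerQuery (.const 0)) .call)) .measureX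

/-- Run `A` to its end. -/
def secondStage : Prog :=
  .loop 4 (.sub (.var 0) (.div (.var 3) (.const 2)))
    (.seq (answerQuery (.add (.mod (.var 3) (.const 2)) (.var 4))) .call)

end Prog

/-- The measure-and-reprogram simulator. -/
def measureReprogram : Simulator := ⟨Prog.firstStage, Prog.secondStage⟩

theorem tableCells_zero {Y : Type*} [Zero Y] (f : Fin 0 → Y) : tableCells f = fun _ => 0 := by
  funext j
  simp [tableCells]

theorem tableCells_snoc {Y : Type*} [Zero Y] {n : ℕ} (f : Fin n → Y) (y : Y) :
    tableCells (Fin.snoc f y : Fin (n + 1) → Y) = Function.update (tableCells f) (1 + n) y := by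
  funext j
  by_cases hj : j = 1 + n
  · subst hj
    rw [Function.update_self, tableCells_one_add _ (Nat.lt_succ_self n)]
    exact Fin.snoc_last (α := fun _ => Y) y f
  · rw [Function.update_of_ne hj]
    by_cases h : j - 1 < n ∧ j ≠ 0
    · have h' : j - 1 < n + 1 ∧ j ≠ 0 := ⟨by omega, h.2⟩
      rw [tableCells, tableCells, dif_pos h, dif_pos h']
      exact Fin.snoc_castSucc (α := fun _ => Y) y f ⟨j - 1, h.1⟩
    · have h' : ¬ (j - 1 < n + 1 ∧ j ≠ 0) := by omega
      rw [tableCells, tableCells, dif_neg h, dif_neg h']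

/-- The table starts at cell 1, so receiving `θ` in cell 0 does not disturb the hash function. -/
theorem residueHash_update_zero {X Y : Type*} [AddCommMonoid Y] (e : X → ℕ) (M : ℕ) (c : ℕ → Y)
    (y : Y) : residueHash e M (Function.update c 0 y) = residueHash e M c := by
  funext x
  exact Finset.sum_congr rfl fun a _ => Function.update_of_ne (by omega) _ _

/-! ### The winning probability of the simulator -/

section Simulation

set_option linter.unusedSectionVars false

variable {X Y Z : Type*} [Fintype X] [DecidableEq X] [Fintype Y] [DecidableEq Y] [AddCommGroup Y]
  [Fintype Z] [DecidableEq Z] {q : ℕ} {enc : X ↪ Fin (2 ^ bits X)}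
  {A : OracleAlgorithm X Y Z q} {m : ℕ} {σ : ℕ → ℕ} {F F' : Frame X Y}
  {W W' : Bool → X → Finset ℕ} {ψ ψ' : Reg X Y Z → ℂ} {p p' : Prog} {s : Branch X Y Z}

theorem sum_map_bind {α β : Type*} (L : Multiset α) (f : α → Multiset β) (G : β → ℝ) :
    ((L.bind f).map G).sum = (L.map fun a => ((f a).map G).sum).sum := by
  rw [Multiset.map_bind, Multiset.sum_bind]

theorem sum_run_seq (G : Branch X Y Z → ℝ) : ((run enc A (.seq p p') s).map G).sum =
    ((run enc A p s).map fun s' => ((run enc A p' s').map G).sum).sum := by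
  rw [run, sum_map_bind]

theorem Triple.sum_run (h : Triple enc A m σ F W ψ p F' W' ψ') (hs : Realizes m σ F W ψ s)
    {G : Branch X Y Z → ℝ} {g : ℝ} (hG : ∀ s', Realizes m σ F' W' ψ' s' → G s' = g) :
    ((run enc A p s).map G).sum = g := by
  obtain ⟨s', hr, hs'⟩ := h s hs
  simp [hr, hG s' hs']

theorem sum_run_fillCells (hs : Realizes 3 σ F W ψ s) (hc : F.cells = fun _ => 0) {M : ℕ}
    (hM : Prog.moduli.eval σ = M) {G : Branch X Y Z → ℝ}
    {g : (ℕ → Y) → ℝ → ℝ}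
    (hG : ∀ c ρ s', Realizes 3 σ { F with cells := c, prob := ρ } W ψ s' → G s' = g c ρ) :
    ((run enc A .fillCells s).map G).sum = ∑ f : Fin (M * M) → Y,
      g (tableCells f) (F.prob / (Fintype.card Y : ℝ) ^ (M * M)) := by
  have hMv : (Expr.mul Prog.moduli Prog.moduli).VarsLT 3 :=
    ⟨Prog.moduli_varsLT (by norm_num), Prog.moduli_varsLT (by norm_num)⟩
  have hev : (Expr.mul Prog.moduli Prog.moduli).eval σ = M * M := by
    simp only [Expr.eval, hM]
  simp only [Prog.fillCells, run, hs.eval hMv, hev]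
  generalize M * M = L
  generalize s.tick _ = s₀, hs.tick _ = hs₀
  induction L generalizing G g with
  | zero =>
    change (Multiset.map G {s₀}).sum = _
    rw [Multiset.map_singleton, Multiset.sum_singleton, pow_zero, div_one, Fintype.sum_unique,
      tableCells_zero, ← hc]
    exact hG F.cells F.prob s₀ hs₀
  | succ n ih =>
    simp only
    -- The draw of the last cell is absorbed into the summed function, which is why the induction
    -- runs over all `G` and `g`.
    rw [sum_map_bind, ih (g := fun c ρ => ∑ y : Y, g (Function.update c (1 + n) y)
      (ρ / Fintype.card Y))]
    · rw [← (Fin.snocEquiv fun _ => Y).sum_comp, Fintype.sum_prod_type, Finset.sum_comm]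
      refine Finset.sum_congr rfl fun y _ => Finset.sum_congr rfl fun f _ => ?_
      have : (Fin.snocEquiv fun _ : Fin (n + 1) => Y) (y, f) = Fin.snoc f y := rfl
      rw [this, tableCells_snoc, pow_succ, div_div]
    · intro c ρ s' hs'
      simp only [Multiset.map_map]
      refine Finset.sum_congr rfl fun y _ => hG _ _ _ ?_
      have hs'' := (hs'.setVar n).tick (1 + (3 : ℕ).size + n.size)
      have haddr : (Expr.add (.const 1) (.var 3)).eval
          ((s'.setVar 3 n).tick (1 + (3 : ℕ).size + n.size)).vars = 1 + n := by
        simp [Expr.eval, Branch.setVar, Branch.tick]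
      refine (Realizes.weaken (n := n) (Realizes.tick ?_ _))
      refine ⟨hs''.vars, ?_, hs''.out, hs''.pos, ?_, hs''.ket⟩
      · change Function.update _ _ _ = _
        rw [haddr]
        exact congrArg (fun c => Function.update c (1 + n) y) hs'.cells
      · change s'.prob / _ = _
        rw [hs'.prob]

theorem sum_run_rand {e : Expr} (hs : Realizes m σ F W ψ s) (he : e.VarsLT m)
    {G : Branch X Y Z → ℝ} {g : ℕ → ℝ} (hG : ∀ r s', Realizes (m + 1) (Function.update σ m r)
      { F with prob := F.prob / (e.eval σ + 1) } W ψ s' → G s' = g r) :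
    ((run enc A (.rand m e) s).map G).sum = ∑ r ∈ range (e.eval σ + 1), g r := by
  simp only [run, hs.eval he, Multiset.map_map]
  refine Finset.sum_congr (s₁ := range (e.eval σ + 1)) rfl fun r _ => hG r _ ?_
  refine Realizes.tick (Realizes.setVar ?_ _) _
  exact ⟨hs.vars, hs.cells, hs.out, hs.pos, by rw [hs.prob], hs.ket⟩

theorem sum_run_measureX (hs : Realizes m σ F W ψ s)
    {G : Branch X Y Z → ℝ} {g : X → ℝ}
    (hG : ∀ x s', Realizes m σ { F with out := some x } W (projX x ψ) s' → G s' = g x) :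
    ((run enc A .measureX s).map G).sum = ∑ x, g x := by
  simp only [run, Multiset.map_map]
  refine Finset.sum_congr rfl fun x _ => hG x _ (Realizes.tick ?_ _)
  refine ⟨hs.vars, hs.cells, rfl, hs.pos, hs.prob, ?_⟩
  funext w r
  simp only [Branch.setKet, hs.ket, ketOf, projX]
  split_ifs <;> rfl

theorem triple_queryLoop {e count : Expr} {K : ℕ} (hq : σ 0 = q) (hn : σ 1 = bits X)
    (he : e.VarsLT 5) (hcount : count.VarsLT 4) (hK : count.eval σ = K) {O : ℕ → X → Y}
    (hO : ∀ x₀, F.out = some x₀ → ∀ j, O j = if e.eval (Function.update σ 4 j) ≠ 0 then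
        Function.update (residueHash (fun x => (enc x).val) (numModuli (bits X) (2 * q)) F.cells)
          x₀ (F.cells 0)
        else residueHash (fun x => (enc x).val) (numModuli (bits X) (2 * q)) F.cells)
    (hO' : F.out = none → ∀ j, e.eval (Function.update σ 4 j) = 0 ∧
      O j = residueHash (fun x => (enc x).val) (numModuli (bits X) (2 * q)) F.cells) :
    Triple enc A 4 σ F (fun _ _ => ∅) ψ (.loop 4 count (.seq (.answerQuery e) .call))
      { F with pos := F.pos + K } (fun _ _ => ∅) (A.evolve O F.pos ψ K) := by
  have := Triple.loop (enc := enc) (A := A) (σ := σ) (p := .seq (.answerQuery e) .call)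
    hcount (fun k => { F with pos := F.pos + k }) (fun _ _ _ => ∅)
    (fun k => A.evolve O F.pos ψ k) fun k _ =>
      (triple_answerQuery (F := { F with pos := F.pos + k }) (H := O k) (by simp [hq])
        (by simp [hn]) he
        (fun x₀ hx₀ => hO x₀ hx₀ k) (fun h => hO' h k)).seq Triple.call
  rwa [hK] at this

/-- With clean work qubits only the basis state `∅` contributes. -/
theorem branchProb_eq (hs : Realizes m σ F (fun _ _ => ∅) ψ s) (P : Matrix Z Z ℂ) :
    Simulator.branchProb P s = F.prob * successProb P ψ := by
  rw [Simulator.branchProb, hs.prob, hs.ket, tsum_eq_single ∅]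
  · simp [ketOf, successProb]
  · intro w hw
    have : P.mulVec (fun _ => (0 : ℂ)) = 0 := Matrix.mulVec_zero P
    simp [ketOf, hw, sqNorm, this]

theorem realizes_initial (A : OracleAlgorithm X Y Z q) :
    Realizes 3 (Simulator.initial A).vars ⟨fun _ => 0, none, 0, 1⟩ (fun _ _ => ∅) A.start
      (Simulator.initial A) := by
  refine ⟨fun _ _ => rfl, rfl, rfl, rfl, rfl, ?_⟩
  funext w r
  by_cases h : w = ∅ <;> simp [Simulator.initial, ketOf, h]

/-- The number r encodes query r / 2 and bit r % 2. The program's test r % 2 + j ≠ 0 is the one in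
`reprogrammed`; for r = 2q the loop is empty. -/
theorem sum_runSecond {c : ℕ → Y} {r : ℕ} {x₀ : X} {ρ : ℝ} (hq : σ 0 = q)
    (hn : σ 1 = bits X) (hr : σ 3 = r)
    (hs : Realizes 4 σ ⟨c, some x₀, r / 2, ρ⟩ (fun _ _ => ∅)
      (projX x₀ (A.state (residueHash (fun x => (enc x).val) (numModuli (bits X) (2 * q))
        c) (r / 2))) s) (θ : Y) (P : Matrix Z Z ℂ) :
    ((measureReprogram.runSecond enc A s θ).map (Simulator.branchProb P)).sum =
      ρ * successProb P (A.reprogrammed (residueHash (fun x => (enc x).val)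
        (numModuli (bits X) (2 * q)) c) x₀ θ (r / 2) (r % 2)) := by
  have hs' : Realizes 4 σ ⟨Function.update c 0 θ, some x₀, r / 2, ρ⟩ (fun _ _ => ∅)
      (projX x₀ (A.state (residueHash (fun x => (enc x).val) (numModuli (bits X) (2 * q))
        c) (r / 2))) (s.setCell 0 θ) :=
    ⟨hs.vars, by simp [Branch.setCell, hs.cells], hs.out, hs.pos, hs.prob, hs.ket⟩
  refine Triple.sum_run (triple_queryLoop (K := q - r / 2) (O := fun j => if r % 2 + j ≠ 0 then
    Function.update (residueHash (fun x => (enc x).val) (numModuli (bits X) (2 * q))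
        c) x₀ θ else residueHash (fun x => (enc x).val)
          (numModuli (bits X) (2 * q)) c) hq hn (by simp [Expr.VarsLT])
    (by simp [Expr.VarsLT]) (by simp [Expr.eval, hq, hr]) ?_ ?_) hs'
    fun s' hs' => branchProb_eq hs' P
  · intro x₁ hx₁ j
    obtain rfl : x₀ = x₁ := Option.some.inj hx₁
    simp only [residueHash_update_zero, Function.update_self]
    simp [Expr.eval, hr]
  · intro h
    cases h

theorem winProb_measureReprogram (enc : X ↪ Fin (2 ^ bits X)) (A : OracleAlgorithm X Y Z q)
    (x₀ : X) (V : X → Y → Matrix Z Z ℂ) :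
    measureReprogram.winProb enc A x₀ V =
      ∑ f : Fin (numModuli (bits X) (2 * q) * numModuli (bits X) (2 * q)) → Y,
      ∑ r ∈ range (2 * q + 1), (∑ θ : Y,
        1 / (Fintype.card Y : ℝ) ^ (numModuli (bits X) (2 * q) * numModuli (bits X) (2 * q)) /
          (2 * q + 1) *
        successProb (V x₀ θ) (A.reprogrammed (residueHash (fun x => (enc x).val)
          (numModuli (bits X) (2 * q)) (tableCells f)) x₀ θ (r / 2) (r % 2))) /
      Fintype.card Y := by
  have h0 := realizes_initial A
  set σ := (Simulator.initial A).vars with hσ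
  have hq : σ 0 = q := rfl
  have hn : σ 1 = bits X := rfl
  set M := numModuli (bits X) (2 * q) with hM
  rw [Simulator.winProb, Simulator.runFirst]
  simp only [measureReprogram, Prog.firstStage]
  rw [sum_run_seq]
  refine (sum_run_fillCells h0 rfl (M := M) (Prog.moduli_eval hq hn) (g := fun c ρ =>
    ∑ r ∈ range (2 * q + 1), (∑ θ : Y, ρ / (2 * q + 1) *
        successProb (V x₀ θ) (A.reprogrammed (residueHash (fun x => (enc x).val) M c)
          x₀ θ (r / 2) (r % 2))) / Fintype.card Y) ?_)
  intro c ρ s hs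
  have hev : (Expr.mul (.const 2) (.var 0)).eval σ = 2 * q := by simp [Expr.eval, hq]
  rw [sum_run_seq, sum_run_rand hs (by simp [Expr.VarsLT]) (g := fun r =>
      (∑ θ : Y, ρ / (2 * q + 1) *
        successProb (V x₀ θ) (A.reprogrammed (residueHash (fun x => (enc x).val) M c)
          x₀ θ (r / 2) (r % 2))) / Fintype.card Y), hev]
  intro r s' hs'
  rw [hev] at hs'
  rw [sum_run_seq]
  refine Triple.sum_run (triple_queryLoop (K := r / 2)
    (O := fun _ => residueHash (fun x => (enc x).val) M c)
    (by simp [hq]) (by simp [hn]) (by simp [Expr.VarsLT]) (by simp [Expr.VarsLT])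
    (by simp [Expr.eval]) ?_ ?_) hs' ?_
  · intro x₁ h
    cases h
  · intro _ j
    exact ⟨rfl, rfl⟩
  intro s'' hs''
  rw [← A.state_eq_evolve] at hs''
  -- Only the measurement outcome `x₀` contributes to the winning probability.
  rw [sum_run_measureX hs'' (g := fun x => if x = x₀ then (∑ θ : Y, ρ / (2 * q + 1) *
        successProb (V x₀ θ) (A.reprogrammed (residueHash (fun x => (enc x).val) M c)
          x₀ θ (r / 2) (r % 2))) / Fintype.card Y else 0)]
  · simp
  · intro x t ht
    have hout : t.out = some x := ht.out
    rw [hout]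
    by_cases hx : x = x₀
    · subst hx
      rw [if_pos rfl, if_pos rfl]
      congr 1
      refine Finset.sum_congr rfl fun θ _ => ?_
      refine sum_runSecond (σ := Function.update σ 3 r) (by simp [hq]) (by simp [hn]) (by simp)
        ?_ θ _
      convert ht using 2
      · simp
      · push_cast
        rfl
    · rw [if_neg (by simpa using hx), if_neg hx]

end Simulation

/-! ### Running time -/

/-- Crude, but sufficient: all variables of the simulator have polynomially bounded values, not just
bit lengths. -/
theorem Nat.size_le_self (n : ℕ) : n.size ≤ n := Nat.size_le.2 n.lt_two_pow_self

namespace Expr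

/-- A bound on the value of an expression, for variables bounded by `B`. -/
def bound (B : ℕ → ℕ) : Expr → ℕ
  | const n => n
  | var i => B i
  | add a b => a.bound B + b.bound B
  | sub a _ => a.bound B
  | mul a b => a.bound B * b.bound B
  | div a _ => a.bound B
  | mod a _ => a.bound B

/-- A bound on the cost of an expression, for variables bounded by `B`. -/
def costBound (B : ℕ → ℕ) : Expr → ℕ
  | const n => 1 + n
  | var i => 1 + i + B i
  | add a b => 1 + a.costBound B + b.costBound B + (add a b).bound B
  | sub a b => 1 + a.costBound B + b.costBound B + (sub a b).bound B
  | mul a b => 1 + a.costBound B + b.costBound B + (mul a b).bound B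
  | div a b => 1 + a.costBound B + b.costBound B + (div a b).bound B
  | mod a b => 1 + a.costBound B + b.costBound B + (mod a b).bound B

theorem eval_le_bound {B σ : ℕ → ℕ} (h : ∀ i, σ i ≤ B i) (e : Expr) : e.eval σ ≤ e.bound B := by
  induction e with
  | const n => exact le_rfl
  | var i => exact h i
  | add a b iha ihb => exact add_le_add iha ihb
  | sub a b iha ihb => exact (Nat.sub_le _ _).trans iha
  | mul a b iha ihb => exact Nat.mul_le_mul iha ihb
  | div a b iha ihb => exact (Nat.div_le_self _ _).trans iha
  | mod a b iha ihb => exact (Nat.mod_le _ _).trans iha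

theorem cost_le_costBound {B σ : ℕ → ℕ} (h : ∀ i, σ i ≤ B i) (e : Expr) :
    e.cost σ ≤ e.costBound B := by
  induction e with
  | const n => exact Nat.add_le_add_left (Nat.size_le_self n) 1
  | var i =>
    exact add_le_add (Nat.add_le_add_left (Nat.size_le_self i) 1)
      ((Nat.size_le_self _).trans (h i))
  | add a b iha ihb =>
    exact add_le_add (add_le_add (Nat.add_le_add_left iha 1) ihb)
      ((Nat.size_le_self _).trans (eval_le_bound h (add a b)))
  | sub a b iha ihb =>
    exact add_le_add (add_le_add (Nat.add_le_add_left iha 1) ihb)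
      ((Nat.size_le_self _).trans (eval_le_bound h (sub a b)))
  | mul a b iha ihb =>
    exact add_le_add (add_le_add (Nat.add_le_add_left iha 1) ihb)
      ((Nat.size_le_self _).trans (eval_le_bound h (mul a b)))
  | div a b iha ihb =>
    exact add_le_add (add_le_add (Nat.add_le_add_left iha 1) ihb)
      ((Nat.size_le_self _).trans (eval_le_bound h (div a b)))
  | mod a b iha ihb =>
    exact add_le_add (add_le_add (Nat.add_le_add_left iha 1) ihb)
      ((Nat.size_le_self _).trans (eval_le_bound h (mod a b)))

end Expr

namespace Prog

/-- The program keeps its variables bounded by `B`. -/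
def Bounded (B : ℕ → ℕ) : Prog → Prop
  | seq p p' => p.Bounded B ∧ p'.Bounded B
  | assign v e => e.bound B ≤ B v
  | rand v e => e.bound B ≤ B v
  | ite _ p p' => p.Bounded B ∧ p'.Bounded B
  | loop v e p => e.bound B ≤ B v ∧ p.Bounded B
  | measure v _ => 1 ≤ B v
  | _ => True

/-- A bound on the running time, for variables bounded by `B` and elements of bit length `l`. -/
def timeBound (B : ℕ → ℕ) (l : ℕ) : Prog → ℕ
  | skip => 0
  | seq p p' => p.timeBound B l + p'.timeBound B l
  | assign v e => 1 + v + e.costBound B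
  | rand v e => 1 + v + e.costBound B
  | ite e p p' => 1 + e.costBound B + (p.timeBound B l + p'.timeBound B l)
  | loop v e p => 1 + e.costBound B + B v * (1 + v + B v + p.timeBound B l)
  | flip t => 1 + t.costBound B
  | toffoli a b t => 1 + a.costBound B + b.costBound B + t.costBound B
  | hadamard t => 1 + t.costBound B
  | phase t => 1 + t.costBound B
  | measure v t => 1 + v + t.costBound B
  | randY a => 1 + a.costBound B + l
  | readC t => 1 + t.costBound B
  | readX k t => 1 + k.costBound B + t.costBound B
  | addY a t => 1 + a.costBound B + t.costBound B + l
  | measureX => 1 + l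
  | readOut k t => 1 + k.costBound B + t.costBound B
  | call => 1

end Prog

theorem update_le_bound {B σ : ℕ → ℕ} (h : ∀ i, σ i ≤ B i) {v n : ℕ} (hn : n ≤ B v) (i : ℕ) :
    Function.update σ v n i ≤ B i := by
  by_cases hi : i = v
  · subst hi
    simpa using hn
  · simpa [hi] using h i

theorem run_bounded {X Y Z : Type*} [Fintype X] [DecidableEq X] [Fintype Y] [DecidableEq Y]
    [AddCommGroup Y] [Fintype Z] [DecidableEq Z] {q : ℕ} {enc : X ↪ Fin (2 ^ bits X)}
    {A : OracleAlgorithm X Y Z q} {B : ℕ → ℕ} {l : ℕ} (hX : bits X ≤ l) (hY : bits Y ≤ l)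
    (p : Prog) (hp : p.Bounded B) (s : Branch X Y Z) (hs : ∀ i, s.vars i ≤ B i) :
    ∀ s' ∈ run enc A p s, (∀ i, s'.vars i ≤ B i) ∧ s'.time ≤ s.time + p.timeBound B l := by
  have hc := Expr.cost_le_costBound hs
  have he := Expr.eval_le_bound hs
  induction p generalizing s with
  | skip =>
    intro s' hs'
    obtain rfl := Multiset.mem_singleton.1 hs'
    exact ⟨hs, le_rfl⟩
  | seq p p' ih ih' =>
    intro s' hs'
    obtain ⟨t, ht, hs'⟩ := Multiset.mem_bind.1 hs'
    obtain ⟨h1, h2⟩ := ih hp.1 s hs hc he t ht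
    obtain ⟨h3, h4⟩ := ih' hp.2 t h1 (Expr.cost_le_costBound h1) (Expr.eval_le_bound h1) s' hs'
    refine ⟨h3, ?_⟩
    simp only [Prog.timeBound]
    omega
  | assign v e =>
    intro s' hs'
    obtain rfl := Multiset.mem_singleton.1 hs'
    refine ⟨update_le_bound hs ((he e).trans hp), ?_⟩
    have := hc e
    have := Nat.size_le_self v
    simp only [Branch.tick, Branch.setVar, Prog.timeBound]
    omega
  | rand v e =>
    intro s' hs'
    obtain ⟨n, hn, rfl⟩ := Multiset.mem_map.1 hs'
    have hn' := Multiset.mem_range.1 hn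
    have := hc e
    have h2 := (he e).trans hp
    have := Nat.size_le_self v
    refine ⟨update_le_bound hs (by omega), ?_⟩
    simp only [Branch.tick, Branch.setVar, Prog.timeBound]
    omega
  | ite e p p' ih ih' =>
    intro s' hs'
    simp only [run] at hs'
    have := hc e
    split_ifs at hs' with h
    · obtain ⟨h1, h2⟩ := ih hp.1 (s.tick (1 + e.cost s.vars)) hs hc he s' hs'
      refine ⟨h1, ?_⟩
      simp only [Branch.tick, Prog.timeBound] at h2 ⊢
      omega
    · obtain ⟨h1, h2⟩ := ih' hp.2 (s.tick (1 + e.cost s.vars)) hs hc he s' hs'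
      refine ⟨h1, ?_⟩
      simp only [Branch.tick, Prog.timeBound] at h2 ⊢
      omega
  | loop v e p ih =>
    intro s' hs'
    simp only [run] at hs'
    have hle : e.eval s.vars ≤ B v := (he e).trans hp.1
    have hce := hc e
    -- Each round costs at most the bound for the body plus the cost of setting the counter, on
    -- every branch, since the body preserves the bounds on the variables.
    have key : ∀ n ≤ B v, ∀ t ∈ (Nat.rec (motive := fun _ => Multiset (Branch X Y Z))
        {s.tick (1 + e.cost s.vars)} (fun k L => L.bind fun s' =>
        run enc A p ((s'.setVar v k).tick (1 + v.size + k.size))) n),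
        (∀ i, t.vars i ≤ B i) ∧
        t.time ≤ s.time + (1 + e.costBound B) + n * (1 + v + B v + p.timeBound B l) := by
      intro n
      induction n with
      | zero =>
        intro _ t ht
        obtain rfl := Multiset.mem_singleton.1 ht
        refine ⟨hs, ?_⟩
        simp only [Branch.tick]
        omega
      | succ n ihn =>
        intro hn t ht
        obtain ⟨t', ht', ht⟩ := Multiset.mem_bind.1 ht
        obtain ⟨h1, h2⟩ := ihn (by omega) t' ht'
        have h1' : ∀ i, ((t'.setVar v n).tick (1 + v.size + n.size)).vars i ≤ B i :=
          update_le_bound h1 (by omega)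
        obtain ⟨h3, h4⟩ := ih hp.2 _ h1' (Expr.cost_le_costBound h1') (Expr.eval_le_bound h1') t ht
        refine ⟨h3, ?_⟩
        have hv := Nat.size_le_self v
        have hnn := Nat.size_le_self n
        simp only [Branch.tick, Branch.setVar] at h4
        rw [Nat.succ_mul]
        omega
    obtain ⟨h1, h2⟩ := key _ hle s' hs'
    refine ⟨h1, h2.trans ?_⟩
    have := Nat.mul_le_mul_right (1 + v + B v + p.timeBound B l) hle
    simp only [Prog.timeBound]
    omega
  | measure v t =>
    intro s' hs'
    obtain ⟨o, -, rfl⟩ := Multiset.mem_map.1 hs'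
    have := hc t
    have := Nat.size_le_self v
    refine ⟨update_le_bound hs ((Bool.toNat_le o).trans hp), ?_⟩
    simp only [Branch.tick, Branch.setVar, Branch.setKet, Prog.timeBound]
    omega
  | randY a =>
    intro s' hs'
    obtain ⟨o, -, rfl⟩ := Multiset.mem_map.1 hs'
    have := hc a
    refine ⟨hs, ?_⟩
    simp only [Branch.tick, Branch.setCell, Prog.timeBound]
    omega
  | measureX =>
    intro s' hs'
    obtain ⟨o, -, rfl⟩ := Multiset.mem_map.1 hs'
    refine ⟨hs, ?_⟩
    simp only [Branch.tick, Branch.setKet, Prog.timeBound]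
    omega
  | flip t | hadamard t | phase t | readC t =>
    intro s' hs'
    obtain rfl := Multiset.mem_singleton.1 hs'
    have := hc t
    refine ⟨hs, ?_⟩
    simp only [Branch.tick, Branch.setKet, Prog.timeBound]
    omega
  | toffoli a b t =>
    intro s' hs'
    obtain rfl := Multiset.mem_singleton.1 hs'
    have := hc a
    have := hc b
    have := hc t
    refine ⟨hs, ?_⟩
    simp only [Branch.tick, Branch.setKet, Prog.timeBound]
    omega
  | readX k t | addY k t | readOut k t =>
    intro s' hs'
    obtain rfl := Multiset.mem_singleton.1 hs'
    have := hc k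
    have := hc t
    refine ⟨hs, ?_⟩
    simp only [Branch.tick, Branch.setKet, Prog.timeBound]
    omega
  | call =>
    intro s' hs'
    obtain rfl := Multiset.mem_singleton.1 hs'
    refine ⟨hs, ?_⟩
    simp only [Branch.tick, Branch.setKet, Prog.timeBound]
    omega

/-! ### Polynomial bounds -/

/-- Functions bounded by a polynomial on the positive integers. -/
def PolyBounded (f : ℕ → ℕ) : Prop := ∃ C d, ∀ N, 1 ≤ N → f N ≤ C * N ^ d

namespace PolyBounded

theorem const (c : ℕ) : PolyBounded fun _ => c := ⟨c, 0, fun N _ => by simp⟩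

theorem id : PolyBounded fun N => N := ⟨1, 1, fun N _ => by simp⟩

theorem add {f g : ℕ → ℕ} (hf : PolyBounded f) (hg : PolyBounded g) :
    PolyBounded fun N => f N + g N := by
  obtain ⟨C, d, hf⟩ := hf
  obtain ⟨C', d', hg⟩ := hg
  refine ⟨C + C', d + d', fun N hN => ?_⟩
  have h1 : N ^ d ≤ N ^ (d + d') := Nat.pow_le_pow_right hN (by omega)
  have h2 : N ^ d' ≤ N ^ (d + d') := Nat.pow_le_pow_right hN (by omega)
  calc f N + g N ≤ C * N ^ d + C' * N ^ d' := add_le_add (hf N hN) (hg N hN)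
    _ ≤ C * N ^ (d + d') + C' * N ^ (d + d') :=
        add_le_add (Nat.mul_le_mul_left _ h1) (Nat.mul_le_mul_left _ h2)
    _ = _ := by ring

theorem mul {f g : ℕ → ℕ} (hf : PolyBounded f) (hg : PolyBounded g) :
    PolyBounded fun N => f N * g N := by
  obtain ⟨C, d, hf⟩ := hf
  obtain ⟨C', d', hg⟩ := hg
  refine ⟨C * C', d + d', fun N hN => ?_⟩
  calc f N * g N ≤ (C * N ^ d) * (C' * N ^ d') := Nat.mul_le_mul (hf N hN) (hg N hN)
    _ = _ := by ring

theorem exprBound {B : ℕ → ℕ → ℕ} (hB : ∀ v, PolyBounded fun N => B N v) (e : Expr) :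
    PolyBounded fun N => e.bound (B N) := by
  induction e with
  | const n => exact const n
  | var i => exact hB i
  | add a b iha ihb => exact iha.add ihb
  | mul a b iha ihb => exact iha.mul ihb
  | sub a b iha ihb | div a b iha ihb | mod a b iha ihb => exact iha

theorem exprCostBound {B : ℕ → ℕ → ℕ} (hB : ∀ v, PolyBounded fun N => B N v) (e : Expr) :
    PolyBounded fun N => e.costBound (B N) := by
  induction e with
  | const n => exact const _
  | var i => exact (const _).add (hB i)
  | add a b iha ihb => exact (((const 1).add iha).add ihb).add (exprBound hB (.add a b))
  | sub a b iha ihb => exact (((const 1).add iha).add ihb).add (exprBound hB (.sub a b))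
  | mul a b iha ihb => exact (((const 1).add iha).add ihb).add (exprBound hB (.mul a b))
  | div a b iha ihb => exact (((const 1).add iha).add ihb).add (exprBound hB (.div a b))
  | mod a b iha ihb => exact (((const 1).add iha).add ihb).add (exprBound hB (.mod a b))

/-- The program is fixed, so its nesting depth is a constant, and the products caused by loops stay
polynomial. -/
theorem timeBound {B : ℕ → ℕ → ℕ} (hB : ∀ v, PolyBounded fun N => B N v) (p : Prog) :
    PolyBounded fun N => p.timeBound (B N) N := by
  have he := exprCostBound hB
  induction p with
  | skip => exact const 0
  | seq p p' ih ih' => exact ih.add ih'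
  | assign v e | rand v e | measure v e => exact (const (1 + v)).add (he e)
  | ite e p p' ih ih' => exact ((const 1).add (he e)).add (ih.add ih')
  | loop v e p ih =>
    exact ((const 1).add (he e)).add ((hB v).mul (((const (1 + v)).add (hB v)).add ih))
  | flip t | hadamard t | phase t | readC t => exact (const 1).add (he t)
  | toffoli a b t => exact (((const 1).add (he a)).add (he b)).add (he t)
  | randY a => exact ((const 1).add (he a)).add id
  | readX k t | readOut k t => exact ((const 1).add (he k)).add (he t)
  | addY a t => exact (((const 1).add (he a)).add (he t)).add id
  | measureX => exact (const 1).add id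
  | call => exact const 1

end PolyBounded

/-- Bounds on the variables of the simulator. -/
def varBound (N v : ℕ) : ℕ := if v < 3 then N else 144 * (N * N * (N * N))

theorem polyBounded_varBound (v : ℕ) : PolyBounded fun N => varBound N v := by
  unfold varBound
  split_ifs
  · exact PolyBounded.id
  · exact (PolyBounded.const 144).mul
      ((PolyBounded.id.mul PolyBounded.id).mul (PolyBounded.id.mul PolyBounded.id))

theorem answerQuery_bounded {N : ℕ} (hN : 1 ≤ N) (e : Expr) :
    (Prog.answerQuery e).Bounded (varBound N) := by
  have h1 : N ≤ 144 * (N * N * (N * N)) := by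
    nlinarith [Nat.mul_le_mul hN hN, Nat.mul_le_mul (Nat.mul_le_mul hN hN) hN]
  have h2 : 2 * (N * (2 * N) + 4) ≤ 144 * (N * N * (N * N)) := by nlinarith [Nat.mul_le_mul hN hN]
  simp [Prog.answerQuery, Prog.Bounded, Prog.compareLayer, Prog.residueQuery, Prog.automatonLayer,
    Prog.automatonStep, Prog.moduli, Expr.bound, varBound, h1, h2]

theorem firstStage_bounded {N : ℕ} (hN : 1 ≤ N) : Prog.firstStage.Bounded (varBound N) := by
  have hNN : 1 ≤ N * N := Nat.mul_le_mul hN hN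
  -- The longest loop fills the table, whose size is the square of the number of moduli; 144 in
  -- `varBound` is 12 squared.
  have h2 : 2 * (N * (2 * N) + 4) ≤ 12 * (N * N) := by nlinarith
  have h3 : 2 * (N * (2 * N) + 4) * (2 * (N * (2 * N) + 4)) ≤ 144 * (N * N * (N * N)) :=
    (Nat.mul_le_mul h2 h2).trans (by nlinarith)
  have h4 : 2 * N ≤ 144 * (N * N * (N * N)) := by nlinarith [Nat.mul_le_mul hNN hNN]
  simp [Prog.firstStage, Prog.fillCells, Prog.Bounded, Prog.moduli, Expr.bound, varBound, h3, h4]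
  exact answerQuery_bounded hN _

theorem secondStage_bounded {N : ℕ} (hN : 1 ≤ N) : Prog.secondStage.Bounded (varBound N) := by
  have h1 : N ≤ 144 * (N * N * (N * N)) := by
    nlinarith [Nat.mul_le_mul hN hN, Nat.mul_le_mul (Nat.mul_le_mul hN hN) hN]
  refine ⟨?_, answerQuery_bounded hN _, trivial⟩
  simpa [Expr.bound, varBound] using h1

/-! ### The measure-and-reprogram theorem -/

theorem theorem1 :
    ∃ (S : Simulator) (C d : ℕ),
      ∀ (X Y Z : Type*) [Fintype X] [DecidableEq X] [Nonempty X]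
        [Fintype Y] [DecidableEq Y] [AddCommGroup Y] [Fintype Z] [DecidableEq Z]
        (enc : X ↪ Fin (2 ^ bits X)) (q : ℕ) (A : OracleAlgorithm X Y Z q),
        (∀ s ∈ S.runFirst enc A, s.out.isSome ∧
          ∀ θ : Y, ∀ s' ∈ S.runSecond enc A s θ, s'.time ≤ C * (q + bits X + bits Y + 1) ^ d) ∧
        ∀ (x₀ : X) (V : X → Y → Matrix Z Z ℂ), (∀ x θ, IsStarProjection (V x θ)) →
          A.winProb x₀ V / (2 * q + 1) ^ 2 ≤ S.winProb enc A x₀ V := by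
  obtain ⟨C, d, hCd⟩ := (PolyBounded.timeBound polyBounded_varBound Prog.firstStage).add
    (PolyBounded.timeBound polyBounded_varBound Prog.secondStage)
  refine ⟨measureReprogram, C, d, fun X Y Z _ _ _ _ _ _ _ _ enc q A => ⟨fun s hs => ⟨?_, ?_⟩, ?_⟩⟩
  -- The last instruction of the first stage is the measurement that stores the output.
  · simp only [Simulator.runFirst, measureReprogram, Prog.firstStage, run] at hs
    obtain ⟨s₁, -, hs⟩ := Multiset.mem_bind.1 hs
    obtain ⟨s₂, -, hs⟩ := Multiset.mem_bind.1 hs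
    obtain ⟨s₃, -, hs⟩ := Multiset.mem_bind.1 hs
    obtain ⟨x, -, rfl⟩ := Multiset.mem_map.1 hs
    rfl
  · intro θ s' hs'
    set N := q + bits X + bits Y + 1 with hNdef
    have hN : 1 ≤ N := by omega
    have hinit : ∀ i, (Simulator.initial A).vars i ≤ varBound N i := by
      intro i
      simp only [Simulator.initial, varBound]
      split_ifs <;> omega
    obtain ⟨h1, h2⟩ := run_bounded (l := N) (by omega) (by omega) _ (firstStage_bounded hN) _
      hinit s hs
    obtain ⟨-, h3⟩ := run_bounded (l := N) (by omega) (by omega) _ (secondStage_bounded hN)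
      (s.setCell 0 θ) h1 s' hs'
    have h0 : (Simulator.initial A).time = 0 := rfl
    have h4 : (s.setCell 0 θ).time = s.time := rfl
    have h5 := hCd N hN
    beta_reduce at h5
    omega
  · intro x₀ V _
    -- All loss is in `winProb_le`: replacing the uniform H by the hash function changes no average.
    refine (A.winProb_le x₀ V).trans (le_of_eq ?_)
    have hinj : Function.Injective fun x => (enc x).val :=
      Fin.val_injective.comp enc.injective
    have havg : ∀ r ∈ range (2 * q + 1), ∀ θ : Y, _ := fun r hr θ =>
      average_successProb_residueHash hinj (n := bits X) (fun x => (enc x).isLt) (V x₀ θ)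
        (ψ := fun H => A.reprogrammed H x₀ θ (r / 2) (r % 2))
        (A.reprogrammed_mem_lowDegree x₀ θ (by have := Finset.mem_range.1 hr; omega) (r % 2))
    rw [winProb_measureReprogram, Finset.sum_div, Finset.sum_div]
    conv_rhs => rw [Finset.sum_comm]
    refine Finset.sum_congr rfl fun r hr => ?_
    simp only [← havg r hr]
    rw [← Finset.sum_div (s := univ), ← Finset.sum_div (s := univ), Finset.sum_comm]
    simp only [← Finset.mul_sum]
    rw [Fintype.card_fun, Fintype.card_fin]
    push_cast
    field_simp
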